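/- Let $1\le M\le N_s$, $N_c\ge 1$, let $\boldsymbol H_c\in\mathbb C^{N_c\times M}$ have rank $r\ge 1$ and singular value decomposition $\boldsymbol H_c=\boldsymbol U_c\boldsymbol\Sigma\boldsymbol V_c^H$ with $\boldsymbol U_c,\boldsymbol V_c$ unitary and singular values $\lambda_1\ge\dots\ge\lambda_r>0$. Let $0<\eta<1$, $P_c\ge 0$, $\sigma_s,\sigma_c,B,\Gamma>0$, $R\ge 0$ and $0<T_{\min}\le T_{\max}$. Consider the problem (P1) of minimizing the energy $$\Big(\frac{\mathrm{tr}(\boldsymbol Q)}{\eta}+P_c\Big)\tau$$ over $\boldsymbol Q\succeq 0$ and $\tau\in[T_{\min},T_{\max}]$ subject to $$\frac{\sigma_s^2N_s}{B\tau}\mathrm{tr}(\boldsymbol Q^{-1})\le\Gamma,\qquad \frac{\tau}{T_{\max}}\log_2\det\Big(\boldsymbol I+\frac{1}{\sigma_c^2}\boldsymbol H_c\boldsymbol Q\boldsymbol H_c^H\Big)\ge R,$$ and the power-allocation problem (P4.2) of minimizing $\frac1\eta\sum_{i=1}^M e_i+P_c\tau$ over $e_i\ge 0$ and $\tau\in[T_{\min},T_{\max}]$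 subject to $$\frac{\sigma_s^2N_s}{B}\sum_{i=1}^M\frac1{e_i}\le\Gamma,\qquad \frac{\tau}{T_{\max}}\sum_{i=1}^r\log_2\Big(1+\frac{\lambda_i^2e_i}{\sigma_c^2\tau}\Big)\ge R .$$ (Here $\mathrm{tr}(\boldsymbol Q^{-1})=+\infty$ for singular $\boldsymbol Q$, and $1/0=+\infty$.) The dual problem is to maximize over $\gamma,\nu\ge 0$ the infimum $\mathcal G(\gamma,\nu)$, over $e_i>0$ and $\tau\in[T_{\min},T_{\max}]$, of $$\frac1\eta\sum_{i=1}^M e_i+P_c\tau+\gamma\Big(\frac{\sigma_s^2N_s}{B}\sum_{i=1}^M\frac1{e_i}-\Gamma\Big)-\nu\Big(\frac{\tau}{T_{\max}}\sum_{i=1}^r\log_2\Big(1+\frac{\lambda_i^2e_i}{\sigma_c^2\tau}\Big)-R\Big).$$ For $\gamma,\nu\ge0$, $i\le r$ and $\tau>0$ put $a_i=\frac{\lambda_i^2}{\eta\sigma_c^2}$, $b_i=\frac1\eta-\frac{\nu}{T_{\max}\ln 2}\frac{\lambda_i^2}{\sigma_c^2}$, $d=-\frac{\gamma\sigma_s^2N_s}{B}$,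 $c_i=d\,\frac{\lambda_i^2}{\sigma_c^2}$, $$k_1=\frac{b_i\tau}{3a_i},\quad k_2=\frac{27a_i^2d\tau-9a_ib_ic_i\tau+2(b_i\tau)^3}{54a_i^3},\quad k_3=\frac{3a_ic_i-(b_i\tau)^2}{9a_i^2},$$ $$\hat e_i(\tau)=-k_1+\sqrt[3]{-k_2+\sqrt{k_2^2+k_3^3}}+\sqrt[3]{-k_2-\sqrt{k_2^2+k_3^3}},$$ with principal values of the complex square and cube roots, and $$g(\tau)=P_c-\frac{\nu}{T_{\max}}\left(\sum_{i=1}^r\log_2\Big(1+\frac{\lambda_i^2\hat e_i(\tau)}{\sigma_c^2\tau}\Big)+\frac1{\ln2}\sum_{i=1}^r\frac{1}{1+\frac{\lambda_i^2\hat e_i(\tau)}{\sigma_c^2\tau}}-\frac r{\ln 2}\right).$$ (If $\hat e_i(\tau)$ is not real, its real part is used in $g$; by the claims below this does not occur at dual optimal multipliers.) Say that $(e,\tau)$ has the closed form for $(\gamma,\nu)$ if * $e_i=\sqrt{\eta\gamma\sigma_s^2N_s/B}$ for $r<i\le M$; * $e_i=\hat e_i(\tau)$ for $1\le i\le r$;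 * $\tau=\min(\max(\bar\tau,T_{\min}),T_{\max})$ for a solution $\bar\tau>0$ of $g(\bar\tau)=0$; if there is no solution, either $g<0$ on $(0,\infty)$ and $\tau=T_{\max}$, or $g>0$ on $(0,\infty)$ and $\tau=T_{\min}$. Then (P4.2) and its dual have optimal solutions, and for every dual optimal $(\gamma^*,\nu^*)$ (used as $(\gamma,\nu)$ in all the formulas): 1. $\hat e_i(\tau)$ is a positive real number for all $\tau>0$ and $i\le r$. 2. Every optimal solution $(e^*,\tau^*)$ of (P4.2) has the closed form, and for $1\le i\le r$ it satisfies $$\frac1\eta-\frac{\gamma^*\sigma_s^2N_s}{B}\frac1{(e_i^*)^2}-\frac{\nu^*}{T_{\max}\ln 2}\,\frac{\lambda_i^2/\sigma_c^2}{1+\frac{\lambda_i^2e_i^*}{\sigma_c^2\tau^*}}=0 .$$ 3. If $g$ has at most one zero in $(0,\infty)$, then conversely every $(e,\tau)$ of the closed form is an optimal solution of (P4.2). This is the case whenever $\gamma^*>0$ and $\nu^*>0$. Finally, $(\boldsymbol Q,\tau)$ is an optimal solution of (P1) if and only if $\boldsymbol Q=\frac1{\tau}\boldsymbol V_c\,\mathrm{diag}(e_1,\dots,e_M)\,\boldsymbol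 V_c^H$ for some optimal solution $(e,\tau)$ of (P4.2). -/

import Mathlib

open Matrix
open scoped ComplexOrder

/-- The data of the problem, with `M` transmit antennas: number `Ns` of sensing receive antennas,
rank `r` of the channel, the `M` singular values `lam` of the channel (in the order of the columns
of `V`, indexed from zero, only the first `r` being nonzero), drain efficiency `eta`, circuit power
`Pc`, noise standard deviations `sigS` (sensing) and `sigC` (communication), bandwidth `B`,
CRB threshold `Gam`, rate requirement `R`, and the bounds `Tmin`, `Tmax` on the "on" duration. -/
structure ISACParams (M : ℕ) where
  Ns : ℕ
  r : ℕ
  lam : Fin M → ℝ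
  eta : ℝ
  Pc : ℝ
  sigS : ℝ
  sigC : ℝ
  B : ℝ
  Gam : ℝ
  R : ℝ
  Tmin : ℝ
  Tmax : ℝ

namespace ISACParams

variable {M : ℕ} (p : ISACParams M)

/-- The rectangular `Nc × M` diagonal matrix of singular values. -/
noncomputable def singMat (Nc : ℕ) : Matrix (Fin Nc) (Fin M) ℂ :=
  fun i j => if (i : ℕ) = (j : ℕ) then ((p.lam j : ℝ) : ℂ) else 0

/-! ### The covariance problem -/

/-- Energy `(tr Q / η + P_c) τ`. -/
noncomputable def covEnergy (Q : Matrix (Fin M) (Fin M) ℂ) (τ : ℝ) : ℝ :=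
  (Q.trace.re / p.eta + p.Pc) * τ

/-- Trace of the CRB matrix. -/
noncomputable def covCRB (Q : Matrix (Fin M) (Fin M) ℂ) (τ : ℝ) : ℝ :=
  p.sigS ^ 2 * p.Ns / (p.B * τ) * (Q⁻¹).trace.re

/-- Average rate in bits; the determinant is real (and at least one) for `Q ⪰ 0`. -/
noncomputable def covRate {Nc : ℕ} (H : Matrix (Fin Nc) (Fin M) ℂ)
    (Q : Matrix (Fin M) (Fin M) ℂ) (τ : ℝ) : ℝ :=
  τ / p.Tmax * Real.logb 2 (1 + ((1 / p.sigC ^ 2 : ℝ) : ℂ) • (H * Q * Hᴴ)).det.re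

/-- Feasibility in the covariance problem. A positive semidefinite singular `Q` has infinite CRB and
violates the CRB constraint, hence `Q` is required to be positive definite. -/
def CovFeasible {Nc : ℕ} (H : Matrix (Fin Nc) (Fin M) ℂ)
    (Q : Matrix (Fin M) (Fin M) ℂ) (τ : ℝ) : Prop :=
  Q.PosDef ∧ p.covCRB Q τ ≤ p.Gam ∧ p.R ≤ p.covRate H Q τ ∧ p.Tmin ≤ τ ∧ τ ≤ p.Tmax

/-- `(Q, τ)` is an optimal solution of the covariance problem. -/
def CovOptimal {Nc : ℕ} (H : Matrix (Fin Nc) (Fin M) ℂ)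
    (Q : Matrix (Fin M) (Fin M) ℂ) (τ : ℝ) : Prop :=
  p.CovFeasible H Q τ ∧
    ∀ Q' τ', p.CovFeasible H Q' τ' → p.covEnergy Q τ ≤ p.covEnergy Q' τ'

/-! ### The power-allocation problem and its dual -/

/-- Energy `(1/η) ∑ eᵢ + P_c τ`. -/
noncomputable def energy (e : Fin M → ℝ) (τ : ℝ) : ℝ :=
  1 / p.eta * ∑ i, e i + p.Pc * τ

/-- CRB as a function of the energies `eᵢ > 0`. -/
noncomputable def crb (e : Fin M → ℝ) : ℝ :=
  p.sigS ^ 2 * p.Ns / p.B * ∑ i, 1 / e i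

/-- Rate as a function of the energies; only the first `r` eigenmodes contribute. -/
noncomputable def rate (e : Fin M → ℝ) (τ : ℝ) : ℝ :=
  τ / p.Tmax * ∑ i ∈ Finset.univ.filter (fun i : Fin M => i.val < p.r),
    Real.logb 2 (1 + p.lam i ^ 2 * e i / (p.sigC ^ 2 * τ))

/-- Domain of the power-allocation problem. A point with some `eᵢ = 0` has infinite CRB, so it is
never feasible; leaving such points out does not change the infimum of the Lagrangian either. -/
def InDomain (e : Fin M → ℝ) (τ : ℝ) : Prop :=
  (∀ i, 0 < e i) ∧ p.Tmin ≤ τ ∧ τ ≤ p.Tmax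

def Feasible (e : Fin M → ℝ) (τ : ℝ) : Prop :=
  p.InDomain e τ ∧ p.crb e ≤ p.Gam ∧ p.R ≤ p.rate e τ

/-- `(e, τ)` is an optimal solution of the power-allocation problem. -/
def Optimal (e : Fin M → ℝ) (τ : ℝ) : Prop :=
  p.Feasible e τ ∧ ∀ e' τ', p.Feasible e' τ' → p.energy e τ ≤ p.energy e' τ'

/-- Partial Lagrangian. -/
noncomputable def lagrangian (e : Fin M → ℝ) (τ γ ν : ℝ) : ℝ :=
  1 / p.eta * ∑ i, e i + γ * (p.crb e - p.Gam) + p.Pc * τ - ν * (p.rate e τ - p.R)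

/-- Dual function: infimum of the Lagrangian over `e` and `τ ∈ [Tmin, Tmax]`. -/
noncomputable def dualFun (γ ν : ℝ) : EReal :=
  ⨅ (e : Fin M → ℝ) (τ : ℝ) (_ : p.InDomain e τ), ((p.lagrangian e τ γ ν : ℝ) : EReal)

/-- `(γ, ν)` is an optimal solution of the dual problem. -/
def DualOptimal (γ ν : ℝ) : Prop :=
  0 ≤ γ ∧ 0 ≤ ν ∧ ∀ γ' ν', 0 ≤ γ' → 0 ≤ ν' → p.dualFun γ' ν' ≤ p.dualFun γ ν

/-! ### The closed form -/

noncomputable def coefA (i : Fin M) : ℝ := p.lam i ^ 2 / (p.eta * p.sigC ^ 2)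

noncomputable def coefB (ν : ℝ) (i : Fin M) : ℝ :=
  1 / p.eta - ν / (Real.log 2 * p.Tmax) * (p.lam i ^ 2 / p.sigC ^ 2)

noncomputable def coefD (γ : ℝ) : ℝ := -(γ * p.sigS ^ 2 * p.Ns / p.B)

noncomputable def coefC (γ : ℝ) (i : Fin M) : ℝ := p.coefD γ * (p.lam i ^ 2 / p.sigC ^ 2)

noncomputable def k1 (ν : ℝ) (i : Fin M) (τ : ℝ) : ℝ := p.coefB ν i / (3 * p.coefA i) * τ

noncomputable def k2 (γ ν : ℝ) (i : Fin M) (τ : ℝ) : ℝ :=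
  (27 * p.coefA i ^ 2 * p.coefD γ * τ - 9 * p.coefA i * p.coefB ν i * p.coefC γ i * τ
    + 2 * (p.coefB ν i * τ) ^ 3) / (54 * p.coefA i ^ 3)

noncomputable def k3 (γ ν : ℝ) (i : Fin M) (τ : ℝ) : ℝ :=
  (3 * p.coefA i * p.coefC γ i - (p.coefB ν i * τ) ^ 2) / (9 * p.coefA i ^ 2)

/-- The principal complex square root of `k₂² + k₃³`, a real number that can be negative. -/
noncomputable def discRoot (γ ν : ℝ) (i : Fin M) (τ : ℝ) : ℂ :=
  (((p.k2 γ ν i τ) ^ 2 + (p.k3 γ ν i τ) ^ 3 : ℝ) : ℂ) ^ (1 / 2 : ℂ)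

/-- Cardano's formula with principal complex square and cube roots. -/
noncomputable def cardano (γ ν : ℝ) (i : Fin M) (τ : ℝ) : ℂ :=
  -(p.k1 ν i τ : ℂ) + (-(p.k2 γ ν i τ : ℂ) + p.discRoot γ ν i τ) ^ (1 / 3 : ℂ)
    + (-(p.k2 γ ν i τ : ℂ) - p.discRoot γ ν i τ) ^ (1 / 3 : ℂ)

/-- The function `êᵢ(τ)`. -/
noncomputable def ehat (γ ν : ℝ) (i : Fin M) (τ : ℝ) : ℝ := (p.cardano γ ν i τ).re

/-- Left-hand side of the equation that determines the "on" duration. -/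
noncomputable def tauLHS (γ ν : ℝ) (τ : ℝ) : ℝ :=
  p.Pc - ν / p.Tmax *
    ((∑ i ∈ Finset.univ.filter (fun i : Fin M => i.val < p.r),
        Real.logb 2 (1 + p.lam i ^ 2 * p.ehat γ ν i τ / (p.sigC ^ 2 * τ)))
      + 1 / Real.log 2 * (∑ i ∈ Finset.univ.filter (fun i : Fin M => i.val < p.r),
        1 / (1 + p.lam i ^ 2 * p.ehat γ ν i τ / (p.sigC ^ 2 * τ)))
      - p.r / Real.log 2)

/-- The positive solutions of the equation for the "on" duration. -/
def TauSol (γ ν : ℝ) : Set ℝ := {t | 0 < t ∧ p.tauLHS γ ν t = 0}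

/-- `τ = min (max τ̄ Tmin) Tmax` for a solution `τ̄` of the equation. If the left-hand side has no
zero, it is read as `τ̄ = +∞` when it is always negative, and as `τ̄ = 0` when it is always
positive. -/
def IsClippedSol (γ ν τ : ℝ) : Prop :=
  (∃ t ∈ p.TauSol γ ν, τ = min (max t p.Tmin) p.Tmax) ∨
  ((∀ t, 0 < t → p.tauLHS γ ν t < 0) ∧ τ = p.Tmax) ∨
  ((∀ t, 0 < t → 0 < p.tauLHS γ ν t) ∧ τ = p.Tmin)

/-- The closed form of the solution in terms of the multipliers. -/
def ClosedForm (γ ν : ℝ) (e : Fin M → ℝ) (τ : ℝ) : Prop :=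
  (∀ i : Fin M, p.r ≤ (i : ℕ) → e i = Real.sqrt (p.eta * γ * p.sigS ^ 2 * p.Ns / p.B)) ∧
  (∀ i : Fin M, (i : ℕ) < p.r → e i = p.ehat γ ν i τ) ∧
  p.IsClippedSol γ ν τ

/-- Stationarity on the first `r` eigenmodes. -/
def Stationary (γ ν : ℝ) (e : Fin M → ℝ) (τ : ℝ) : Prop :=
  ∀ i : Fin M, (i : ℕ) < p.r →
    1 / p.eta - γ * p.sigS ^ 2 * p.Ns / p.B * (1 / e i ^ 2)
      - ν / (Real.log 2 * p.Tmax) *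
        ((p.lam i ^ 2 / p.sigC ^ 2) / (1 + p.lam i ^ 2 * e i / (p.sigC ^ 2 * τ))) = 0

end ISACParams

/-! ### Cardano's formula with principal roots -/

namespace Complex

/-! The power-allocation problem is convex: the rate is a sum of perspectives of concave logarithms.
Feasible points of bounded energy form a compact set, so an optimum exists. A Slater point and
Hahn–Banach separation yield multipliers with zero duality gap (`exists_multipliers`), so every
primal optimum minimizes the Lagrangian at every dual optimum.

The Lagrangian splits over the eigenmodes. Its derivative in one energy is strictly increasing, so
it has at most one positive zero. Clearing denominators on an active mode gives a cubic that is
nonpositive and nonincreasing at the origin, and the principal roots in Cardano's formula select its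
largest real root, which is positive (`cardano_spec`). The derivative in the duration, at energies
`ehat`, is `tauLHS`; its sign at a minimizer over `[Tmin, Tmax]` gives the clipping rule. Since
`ehat / τ` is nonincreasing in `τ`, `tauLHS` is monotone, strictly so when both multipliers are
positive. If it has at most one zero, the closed form describes a single point, which must be the
optimum already known to exist.

For the covariance problem, pass to `Vᴴ * Q * V` and keep only its diagonal. The energy is
unchanged, the trace of the inverse does not increase, and by Hadamard's inequality the determinant
does not decrease. At an optimum some active constraint forces equality in one of these two
inequalities, hence diagonality (`covOptimal_iff`). -/

theorem ofReal_cpow_half_of_nonneg {x : ℝ} (hx : 0 ≤ x) :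
    (x : ℂ) ^ (1 / 2 : ℂ) = (Real.sqrt x : ℂ) := by
  rw [Real.sqrt_eq_rpow, ofReal_cpow hx]
  norm_num

theorem ofReal_cpow_half_of_neg {x : ℝ} (hx : x < 0) :
    (x : ℂ) ^ (1 / 2 : ℂ) = (Real.sqrt (-x) : ℂ) * I := by
  have h : (1 / 2 : ℂ) = ((1 / 2 : ℝ) : ℂ) := by norm_num
  rw [h, cpow_ofReal, arg_ofReal_of_neg hx, norm_real, Real.norm_of_nonpos hx.le,
    ← Real.sqrt_eq_rpow, mul_one_div, Real.cos_pi_div_two, Real.sin_pi_div_two]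
  simp

/-- The principal cube roots of two conjugate numbers in the open upper and lower half-planes add
up to the largest real root of the associated depressed cubic. -/
theorem conj_cube_roots_add (a s : ℝ) (hs : 0 < s) {q : ℝ} (hq : 0 ≤ q)
    (hqa : q ^ 3 = a ^ 2 + s ^ 2) :
    ∃ y : ℝ, 0 ≤ y ∧ q ≤ y ^ 2 ∧ y ^ 3 - 3 * q * y - 2 * a = 0 ∧
      ((a : ℂ) + s * I) ^ (1 / 3 : ℂ) + ((a : ℂ) - s * I) ^ (1 / 3 : ℂ) = y := by
  set z : ℂ := (a : ℂ) + s * I with hz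
  have hzim : z.im = s := by simp [hz]
  have hzre : z.re = a := by simp [hz]
  have hconj : (a : ℂ) - s * I = (starRingEnd ℂ) z := by
    simp [hz, sub_eq_add_neg]
  have harg0 : 0 ≤ arg z := arg_nonneg_iff.2 (by rw [hzim]; exact hs.le)
  have hargpi : arg z ≠ Real.pi := by
    intro h
    rw [arg_eq_pi_iff] at h
    exact hs.ne' (hzim ▸ h.2)
  have h3 : (1 / 3 : ℂ) = ((1 / 3 : ℝ) : ℂ) := by norm_num
  set w : ℂ := z ^ (1 / 3 : ℂ) with hw
  have hw3 : w ^ 3 = z := by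
    rw [hw, one_div]
    exact_mod_cast cpow_nat_inv_pow z (n := 3) (by norm_num)
  -- Principal powers commute with conjugation only off the negative real axis; this is where `0 <
  -- s` enters.
  have hwc : ((a : ℂ) - s * I) ^ (1 / 3 : ℂ) = (starRingEnd ℂ) w := by
    rw [hconj, h3, conj_cpow _ _ hargpi, conj_ofReal, ← h3]
  have hn : w.re ^ 2 + w.im ^ 2 = q := by
    have h1 : (normSq w) ^ 3 = q ^ 3 := by
      rw [← map_pow, hw3, normSq_apply, hzre, hzim, hqa]; ring
    have h2 := (pow_left_inj₀ (normSq_nonneg w) hq (by norm_num)).1 h1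
    rw [normSq_apply] at h2
    linarith
  have hre : w.re ^ 3 - 3 * w.re * w.im ^ 2 = a := by
    rw [← hzre, ← hw3]
    simp [pow_succ]
    ring
  have hwre : w.re = ‖z‖ ^ (1 / 3 : ℝ) * Real.cos (arg z * (1 / 3)) := by
    rw [hw, h3, cpow_ofReal_re]
  have hwim : w.im = ‖z‖ ^ (1 / 3 : ℝ) * Real.sin (arg z * (1 / 3)) := by
    rw [hw, h3, cpow_ofReal_im]
  -- The argument of `z` lies in `[0, π]`, so that of `w` is at most `π / 3`. Hence `2 * w.re ≥ ‖w‖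
  -- = √q`, which gives `q ≤ y ^ 2`.
  have hcos : 1 / 2 ≤ Real.cos (arg z * (1 / 3)) := by
    rw [← Real.cos_pi_div_three]
    have := arg_le_pi z
    exact Real.cos_le_cos_of_nonneg_of_le_pi (by positivity) (by linarith [Real.pi_pos])
      (by linarith)
  set ρ := ‖z‖ ^ (1 / 3 : ℝ) with hρ
  have hρ0 : 0 ≤ ρ := by positivity
  have hqρ : q = ρ ^ 2 := by
    rw [← hn, hwre, hwim]
    linear_combination ρ ^ 2 * Real.cos_sq_add_sin_sq (arg z * (1 / 3))
  have hy : ρ ≤ 2 * w.re := by rw [hwre]; nlinarith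
  refine ⟨2 * w.re, hρ0.trans hy, ?_, ?_, ?_⟩
  · rw [hqρ]
    exact pow_le_pow_left₀ hρ0 hy 2
  · rw [← hre, ← hn]; ring
  · rw [hwc, add_conj]

/-- With real cube roots `A`, `C` this is `(A + C)³ = 3AC(A + C) + A³ + C³`. -/
theorem cube_roots_add_of_nonneg {a b : ℝ} (ha : 0 ≤ a) (hb : 0 ≤ b) {q : ℝ} (hq : 0 ≤ q)
    (hqa : q ^ 3 = a * b) :
    ∃ y : ℝ, 0 ≤ y ∧ q ≤ y ^ 2 ∧ y ^ 3 - 3 * q * y - (a + b) = 0 ∧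
      (a : ℂ) ^ (1 / 3 : ℂ) + (b : ℂ) ^ (1 / 3 : ℂ) = y := by
  have h3 : (1 / 3 : ℂ) = ((1 / 3 : ℝ) : ℂ) := by norm_num
  have key : ∀ x : ℝ, 0 ≤ x → (x ^ (1 / 3 : ℝ)) ^ 3 = x := fun x hx => by
    rw [one_div]
    exact_mod_cast Real.rpow_inv_natCast_pow hx (n := 3) (by norm_num)
  have hA := Real.rpow_nonneg ha (1 / 3)
  have hB := Real.rpow_nonneg hb (1 / 3)
  have hA3 := key a ha
  have hB3 := key b hb
  set A := a ^ (1 / 3 : ℝ) with hAdef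
  set C := b ^ (1 / 3 : ℝ) with hCdef
  have hAB : q = A * C := by
    refine (pow_left_inj₀ hq (mul_nonneg hA hB) (n := 3) (by norm_num)).1 ?_
    rw [hqa, mul_pow, hA3, hB3]
  refine ⟨A + C, add_nonneg hA hB, ?_, ?_, ?_⟩
  · rw [hAB]; nlinarith [mul_nonneg hA hB]
  · rw [hAB, ← hA3, ← hB3]; ring
  · rw [h3, ← ofReal_cpow ha, ← ofReal_cpow hb, ofReal_add]

/-- When the discriminant is nonnegative, `k2 ≤ 0` keeps both radicands nonnegative; the principal
cube root of a negative real is not real. The bounds `0 ≤ y` and `-k3 ≤ y ^ 2` place `y` where the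
depressed cubic is increasing, so it is the largest real root. -/
theorem cardano_principal {k2 k3 : ℝ} (hk3 : k3 ≤ 0) (h : 0 ≤ k2 ^ 2 + k3 ^ 3 → k2 ≤ 0) :
    ∃ y : ℝ, 0 ≤ y ∧ -k3 ≤ y ^ 2 ∧ y ^ 3 + 3 * k3 * y + 2 * k2 = 0 ∧
      (-(k2 : ℂ) + ((k2 ^ 2 + k3 ^ 3 : ℝ) : ℂ) ^ (1 / 2 : ℂ)) ^ (1 / 3 : ℂ) +
        (-(k2 : ℂ) - ((k2 ^ 2 + k3 ^ 3 : ℝ) : ℂ) ^ (1 / 2 : ℂ)) ^ (1 / 3 : ℂ) = y := by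
  rcases lt_or_ge (k2 ^ 2 + k3 ^ 3) 0 with hD | hD
  · rw [ofReal_cpow_half_of_neg hD]
    obtain ⟨y, h1, h2, h3, h4⟩ := conj_cube_roots_add (-k2) (Real.sqrt (-(k2 ^ 2 + k3 ^ 3)))
      (Real.sqrt_pos.2 (by linarith)) (q := -k3) (by linarith)
      (by rw [Real.sq_sqrt (by linarith)]; ring)
    refine ⟨y, h1, h2, by linarith, ?_⟩
    rw [← h4, ofReal_neg]
  · rw [ofReal_cpow_half_of_nonneg hD]
    have hk2 := h hD
    set s := Real.sqrt (k2 ^ 2 + k3 ^ 3) with hs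
    have hs0 : 0 ≤ s := Real.sqrt_nonneg _
    have hs2 : s ^ 2 = k2 ^ 2 + k3 ^ 3 := Real.sq_sqrt hD
    have hk33 : k3 ^ 3 ≤ 0 := by
      have : 0 ≤ (-k3) ^ 3 := pow_nonneg (by linarith) 3
      nlinarith
    have hsk : s ≤ -k2 := abs_le_of_sq_le_sq' (by nlinarith) (by linarith) |>.2
    obtain ⟨y, h1, h2, h3, h4⟩ := cube_roots_add_of_nonneg (a := -k2 + s) (b := -k2 - s)
      (by linarith) (by linarith) (q := -k3) (by linarith) (by nlinarith)
    refine ⟨y, h1, h2, by linarith, ?_⟩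
    rw [← h4]
    push_cast
    rfl

end Complex

/-- If the cubic with depressed coefficients `k2`, `k3` and shift `k1` is nonincreasing and negative
at the origin, then Cardano's formula with principal roots gives a positive root. -/
theorem cardano_pos_root {k1 k2 k3 : ℝ} (h1 : k1 ^ 2 ≤ -k3)
    (h0 : k1 ^ 3 + 3 * k3 * k1 + 2 * k2 < 0 ∨
      (k1 ^ 3 + 3 * k3 * k1 + 2 * k2 = 0 ∧ k1 < 0 ∧ k2 ≤ 0)) :
    ∃ x : ℝ, 0 < x ∧ (x + k1) ^ 3 + 3 * k3 * (x + k1) + 2 * k2 = 0 ∧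
      -(k1 : ℂ) + (-(k2 : ℂ) + ((k2 ^ 2 + k3 ^ 3 : ℝ) : ℂ) ^ (1 / 2 : ℂ)) ^ (1 / 3 : ℂ) +
        (-(k2 : ℂ) - ((k2 ^ 2 + k3 ^ 3 : ℝ) : ℂ) ^ (1 / 2 : ℂ)) ^ (1 / 3 : ℂ) = x := by
  have hk3 : k3 ≤ 0 := by nlinarith [sq_nonneg k1]
  have hdisc : 0 ≤ k2 ^ 2 + k3 ^ 3 → k2 ≤ 0 := by
    intro hD
    rcases h0 with h0 | ⟨-, -, h0⟩
    · by_contra! hk2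
      obtain ⟨m, hm, rfl⟩ : ∃ m : ℝ, 0 ≤ m ∧ k3 = -m ^ 2 :=
        ⟨Real.sqrt (-k3), Real.sqrt_nonneg _, by rw [Real.sq_sqrt (by linarith)]; ring⟩
      have hm3 : m ^ 3 ≤ k2 := abs_le_of_sq_le_sq' (by nlinarith) hk2.le |>.2
      have hk1 : -m ≤ k1 := abs_le_of_sq_le_sq' (by linarith) hm |>.1
      -- This product is `k1³ - 3m²k1 + 2m³`, at most the value of the cubic at the origin because
      -- `m³ ≤ k2`; that value was assumed negative.
      have : 0 ≤ (k1 - m) ^ 2 * (k1 + 2 * m) :=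
        mul_nonneg (sq_nonneg _) (by linarith)
      nlinarith
    · exact h0
  obtain ⟨y, hy0, hy, hroot, heq⟩ := Complex.cardano_principal hk3 hdisc
  have hky : k1 ≤ y := abs_le_of_sq_le_sq' (h1.trans hy) hy0 |>.2
  have hlt : k1 < y := by
    refine lt_of_le_of_ne hky ?_
    rintro rfl
    rcases h0 with h0 | ⟨-, h0, -⟩ <;> linarith
  refine ⟨y - k1, sub_pos.2 hlt, by simpa using hroot, ?_⟩
  rw [add_assoc, heq]
  push_cast
  ring

namespace ISACParams

variable {M : ℕ} (p : ISACParams M)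

/-! ### The Lagrangian as a sum over the eigenmodes -/

/-- The standing assumptions on the parameters. -/
structure Regular : Prop where
  eta_pos : 0 < p.eta
  Pc_nonneg : 0 ≤ p.Pc
  sigS_pos : 0 < p.sigS
  sigC_pos : 0 < p.sigC
  B_pos : 0 < p.B
  Ns_pos : 0 < (p.Ns : ℝ)
  Gam_pos : 0 < p.Gam
  Tmin_pos : 0 < p.Tmin
  Tmin_le : p.Tmin ≤ p.Tmax
  r_pos : 0 < p.r
  r_le : p.r ≤ M
  lam_pos : ∀ i : Fin M, (i : ℕ) < p.r → 0 < p.lam i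
  lam_zero : ∀ i : Fin M, p.r ≤ (i : ℕ) → p.lam i = 0

/-- Weight of the reciprocal energies in the CRB. -/
noncomputable def noise : ℝ := p.sigS ^ 2 * p.Ns / p.B

/-- Signal-to-noise ratio of an eigenmode per unit of power. -/
noncomputable def gain (i : Fin M) : ℝ := p.lam i ^ 2 / p.sigC ^ 2

noncomputable def price (ν : ℝ) : ℝ := ν / (Real.log 2 * p.Tmax)

/-- Contribution of an eigenmode with energy `x` to the Lagrangian. -/
noncomputable def modeCost (γ ν : ℝ) (i : Fin M) (x τ : ℝ) : ℝ :=
  1 / p.eta * x + γ * (p.noise * (1 / x)) - ν / p.Tmax * (τ * Real.logb 2 (1 + p.gain i * x / τ))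

/-- Derivative of `modeCost` in the energy. -/
noncomputable def modeSlope (γ ν : ℝ) (i : Fin M) (x τ : ℝ) : ℝ :=
  1 / p.eta - γ * p.noise * (1 / x ^ 2) - p.price ν * (p.gain i / (1 + p.gain i * x / τ))

/-- The function `u ↦ (ln (1 + u) + 1 / (1 + u) - 1) / ln 2`. -/
noncomputable def rateSlope (u : ℝ) : ℝ :=
  Real.logb 2 (1 + u) + 1 / Real.log 2 * (1 / (1 + u)) - 1 / Real.log 2

variable {p}

theorem Regular.Tmax_pos (h : p.Regular) : 0 < p.Tmax := h.Tmin_pos.trans_le h.Tmin_le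

theorem Regular.noise_pos (h : p.Regular) : 0 < p.noise := by
  have := h.sigS_pos; have := h.B_pos; have := h.Ns_pos
  unfold noise; positivity

theorem gain_nonneg (i : Fin M) : 0 ≤ p.gain i := by unfold gain; positivity

theorem Regular.gain_pos (h : p.Regular) {i : Fin M} (hi : (i : ℕ) < p.r) : 0 < p.gain i := by
  have := h.sigC_pos; have := h.lam_pos i hi
  unfold gain; positivity

theorem Regular.gain_zero (h : p.Regular) {i : Fin M} (hi : p.r ≤ (i : ℕ)) : p.gain i = 0 := by
  simp [gain, h.lam_zero i hi]

theorem snr_eq (i : Fin M) (x τ : ℝ) :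
    p.lam i ^ 2 * x / (p.sigC ^ 2 * τ) = p.gain i * x / τ := by
  rw [gain, div_mul_eq_mul_div, div_div]

/-- Modes of zero gain contribute nothing to the rate, so all `M` modes can be treated uniformly. -/
theorem sum_filter_eq (f : Fin M → ℝ)
    (hf : ∀ i : Fin M, p.r ≤ (i : ℕ) → f i = 0) :
    ∑ i ∈ Finset.univ.filter (fun i : Fin M => i.val < p.r), f i = ∑ i, f i := by
  refine Finset.sum_subset (Finset.filter_subset _ _) fun i _ hi => hf i ?_
  simpa using hi

theorem Regular.card_filter (h : p.Regular) :
    (Finset.univ.filter (fun i : Fin M => i.val < p.r)).card = p.r := by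
  have := Fin.card_filter_val_lt (n := M) (m := p.r)
  simpa [h.r_le] using this

theorem Regular.rate_eq (h : p.Regular) (e : Fin M → ℝ) (τ : ℝ) :
    p.rate e τ = τ / p.Tmax * ∑ i, Real.logb 2 (1 + p.gain i * e i / τ) := by
  unfold rate
  simp only [snr_eq]
  rw [sum_filter_eq]
  intro i hi
  simp [h.gain_zero hi]

/-- Separability: for a fixed duration, each energy can be minimized on its own. -/
theorem Regular.lagrangian_eq (h : p.Regular) (e : Fin M → ℝ) (τ γ ν : ℝ) :
    p.lagrangian e τ γ ν =
      ∑ i, p.modeCost γ ν i (e i) τ + (p.Pc * τ - γ * p.Gam + ν * p.R) := by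
  unfold lagrangian modeCost crb noise
  rw [h.rate_eq, Finset.sum_sub_distrib, Finset.sum_add_distrib]
  simp only [← Finset.mul_sum]
  ring

/-- The constant `r / log 2` is shared out among the `r` active modes; since `rateSlope 0 = 0`, the
sum then extends to all modes. -/
theorem Regular.tauLHS_eq (h : p.Regular) (γ ν t : ℝ) :
    p.tauLHS γ ν t = p.Pc - ν / p.Tmax * ∑ i, rateSlope (p.gain i * p.ehat γ ν i t / t) := by
  rw [tauLHS, ← sum_filter_eq (p := p)]
  · simp only [snr_eq, rateSlope, Finset.sum_sub_distrib, Finset.sum_add_distrib, Finset.mul_sum,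
      Finset.sum_const, h.card_filter, nsmul_eq_mul, mul_one_div]
  · intro i hi
    simp [h.gain_zero hi, rateSlope]

theorem one_add_snr_pos (i : Fin M) {x τ : ℝ} (hx : 0 < x) (hτ : 0 < τ) :
    0 < 1 + p.gain i * x / τ := by
  have := p.gain_nonneg i
  positivity

theorem hasDerivAt_modeCost (γ ν : ℝ) (i : Fin M) {x τ : ℝ} (hx : 0 < x) (hτ : 0 < τ) :
    HasDerivAt (fun x => p.modeCost γ ν i x τ) (p.modeSlope γ ν i x τ) x := by
  have hlog := Real.log_pos one_lt_two
  have hu := p.one_add_snr_pos i hx hτ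
  have h1 : HasDerivAt (fun x : ℝ => 1 / x) (-(1 / x ^ 2)) x := by
    simpa [one_div] using hasDerivAt_inv hx.ne'
  have h2 : HasDerivAt (fun x : ℝ => 1 + p.gain i * x / τ) (p.gain i * 1 / τ) x :=
    (((hasDerivAt_id x).const_mul _).div_const _).const_add _
  have h3 := ((h2.log hu.ne').div_const (Real.log 2)).const_mul τ
  refine ((((hasDerivAt_id x).const_mul (1 / p.eta)).add ((h1.const_mul p.noise).const_mul γ)).sub
    (h3.const_mul (ν / p.Tmax))).congr_deriv ?_
  unfold modeSlope price
  field_simp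
  ring

theorem hasDerivAt_modeCost_tau (γ ν : ℝ) (i : Fin M) {x τ : ℝ} (hx : 0 < x) (hτ : 0 < τ) :
    HasDerivAt (fun τ => p.modeCost γ ν i x τ)
      (-(ν / p.Tmax * rateSlope (p.gain i * x / τ))) τ := by
  have hlog := Real.log_pos one_lt_two
  have hu := p.one_add_snr_pos i hx hτ
  have h2 : HasDerivAt (fun τ : ℝ => 1 + p.gain i * x / τ) (p.gain i * x * (-(τ ^ 2)⁻¹)) τ := by
    simpa [div_eq_mul_inv] using
      ((hasDerivAt_inv hτ.ne').const_mul (p.gain i * x)).const_add 1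
  have h3 := (hasDerivAt_id τ).mul ((h2.log hu.ne').div_const (Real.log 2))
  refine ((h3.const_mul (ν / p.Tmax)).const_sub
    (1 / p.eta * x + γ * (p.noise * (1 / x)))).congr_deriv ?_
  unfold rateSlope Real.logb
  have hu' : τ + p.gain i * x ≠ 0 := by
    have := p.gain_nonneg i
    positivity
  simp only [id]
  field_simp
  ring

/-- Up to the factor `1 / log 2` the derivative is `u / (1 + u)²`. It vanishes at zero, so the
elementary bound `1 - 1 / x ≤ log x` is enough only for `a > 0`; at `a = 0` the strict logarithm
inequality is needed. -/
theorem rateSlope_strictMonoOn : StrictMonoOn rateSlope (Set.Ici 0) := by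
  intro a ha b hb hab
  simp only [Set.mem_Ici] at ha hb
  have hlog := Real.log_pos one_lt_two
  have key : Real.log (1 + a) + 1 / (1 + a) < Real.log (1 + b) + 1 / (1 + b) := by
    have h1 := Real.one_sub_inv_le_log_of_pos (x := (1 + b) / (1 + a)) (by positivity)
    rw [Real.log_div (by positivity) (by positivity), inv_div] at h1
    have h2 : 1 / (1 + a) - 1 / (1 + b) < 1 - (1 + a) / (1 + b) ∨ a = 0 := by
      rcases ha.eq_or_lt with h0 | h0
      · exact Or.inr h0.symm
      · left
        rw [div_sub_div _ _ (by positivity) (by positivity), one_sub_div (by positivity),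
          div_lt_div_iff₀ (by positivity) (by positivity)]
        nlinarith [mul_pos (mul_pos h0 (sub_pos.2 hab)) (by positivity : (0:ℝ) < 1 + b)]
    rcases h2 with h2 | rfl
    · linarith
    · have h3 := Real.one_sub_inv_le_log_of_pos (x := 1 + b) (by positivity)
      have h4 : 1 + b ≠ 1 := by linarith
      have h5 := Real.log_lt_sub_one_of_pos (x := (1 + b)⁻¹) (by positivity)
        (by simpa using h4)
      rw [Real.log_inv] at h5
      simp only [add_zero, Real.log_one, div_one, one_div] at *
      linarith
  unfold rateSlope Real.logb
  have : ∀ u : ℝ, Real.log (1 + u) / Real.log 2 + 1 / Real.log 2 * (1 / (1 + u)) - 1 / Real.log 2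
      = (Real.log (1 + u) + 1 / (1 + u) - 1) / Real.log 2 := fun u => by ring
  rw [this, this]
  exact div_lt_div_of_pos_right (by linarith) hlog

/-! ### The cubic equation of an eigenmode -/

/-- Multipliers for which the cubic equation of every eigenmode has a positive root. -/
def Proper (p : ISACParams M) (γ ν : ℝ) : Prop :=
  0 ≤ γ ∧ 0 ≤ ν ∧ (0 < γ ∨ ∀ i : Fin M, (i : ℕ) < p.r → p.coefB ν i < 0)

/-- Multiplying `modeSlope` by `x²(t + gain * x)` and dividing by `t` in its denominators' place
gives `a x³ + b t x² + c x + d t`, whose value and slope at the origin are nonpositive. -/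
theorem Regular.cardano_spec (h : p.Regular) {γ ν : ℝ} (hp : p.Proper γ ν) {i : Fin M}
    (hi : (i : ℕ) < p.r) {t : ℝ} (ht : 0 < t) :
    ∃ x : ℝ, 0 < x ∧ p.cardano γ ν i t = x ∧ p.modeSlope γ ν i x t = 0 := by
  obtain ⟨hγ, hν, hp⟩ := hp
  have heta := h.eta_pos
  have hg := h.gain_pos hi
  have hn := h.noise_pos
  have ha : p.coefA i = p.gain i / p.eta := by
    unfold coefA gain; rw [mul_comm, div_div]
  have hd : p.coefD γ = -(γ * p.noise) := by
    unfold coefD noise; ring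
  have hc : p.coefC γ i = -(γ * p.noise) * p.gain i := by
    unfold coefC; rw [hd]; rfl
  have ha0 : 0 < p.coefA i := by rw [ha]; positivity
  -- The shift by `k1` removes the quadratic term of the monic cubic.
  have hsum : ∀ x, (x + p.k1 ν i t) ^ 3 + 3 * p.k3 γ ν i t * (x + p.k1 ν i t)
      + 2 * p.k2 γ ν i t = x ^ 3 + p.coefB ν i * t / p.coefA i * x ^ 2
        + p.coefC γ i / p.coefA i * x + p.coefD γ * t / p.coefA i := by
    intro x
    unfold k1 k2 k3
    field_simp
    ring
  have h1 : (p.k1 ν i t) ^ 2 ≤ -p.k3 γ ν i t := by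
    have : -p.k3 γ ν i t - (p.k1 ν i t) ^ 2 = γ * p.noise * p.gain i / (3 * p.coefA i) := by
      unfold k3 k1; rw [hc]; field_simp; ring
    have h2 : 0 ≤ γ * p.noise * p.gain i / (3 * p.coefA i) := by positivity
    linarith
  have h0 : p.k1 ν i t ^ 3 + 3 * p.k3 γ ν i t * p.k1 ν i t + 2 * p.k2 γ ν i t < 0 ∨
      (p.k1 ν i t ^ 3 + 3 * p.k3 γ ν i t * p.k1 ν i t + 2 * p.k2 γ ν i t = 0 ∧
        p.k1 ν i t < 0 ∧ p.k2 γ ν i t ≤ 0) := by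
    have h3 := hsum 0
    simp only [zero_add] at h3
    rw [h3]
    rcases hγ.eq_or_lt with h0 | h0
    -- For `γ = 0` the cubic degenerates to `x²(x + 3 k1)`, which has a positive root exactly
    -- because `b < 0`.
    · right
      have hb := (hp.resolve_left h0.not_lt) i hi
      have hk1 : p.k1 ν i t < 0 := by
        unfold k1
        exact mul_neg_of_neg_of_pos (div_neg_of_neg_of_pos hb (by positivity)) ht
      have hk2 : p.k2 γ ν i t = p.k1 ν i t ^ 3 := by
        unfold k1 k2; rw [hd, hc, ← h0]; field_simp; ring
      refine ⟨by rw [hd, ← h0]; simp, hk1, ?_⟩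
      rw [hk2]
      exact (Odd.pow_neg (by decide) hk1).le
    · left
      have : p.coefD γ * t / p.coefA i < 0 := by
        rw [hd]
        exact div_neg_of_neg_of_pos (mul_neg_of_neg_of_pos (by nlinarith) ht) ha0
      simpa using this
  obtain ⟨x, hx, hroot, heq⟩ := cardano_pos_root h1 h0
  refine ⟨x, hx, by rw [← heq]; rfl, ?_⟩
  rw [hsum, hc, hd, ha] at hroot
  have hb : p.coefB ν i = 1 / p.eta - p.price ν * p.gain i := rfl
  rw [hb] at hroot
  have hu : t + p.gain i * x ≠ 0 := by positivity
  have hlin : (1 / p.eta * x ^ 2 - γ * p.noise) * (t + p.gain i * x)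
      - p.price ν * p.gain i * t * x ^ 2 = 0 := by
    field_simp at hroot ⊢
    linear_combination hroot
  have : p.modeSlope γ ν i x t = ((1 / p.eta * x ^ 2 - γ * p.noise) * (t + p.gain i * x)
      - p.price ν * p.gain i * t * x ^ 2) / (x ^ 2 * (t + p.gain i * x)) := by
    unfold modeSlope
    field_simp
  rw [this, hlin, zero_div]

end ISACParams

namespace ISACParams

variable {M : ℕ} {p : ISACParams M}

/-! ### Dependence of the roots on the duration -/

theorem Regular.ehat_pos (h : p.Regular) {γ ν : ℝ} (hp : p.Proper γ ν) {i : Fin M}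
    (hi : (i : ℕ) < p.r) {t : ℝ} (ht : 0 < t) : 0 < p.ehat γ ν i t := by
  obtain ⟨x, hx, hc, -⟩ := h.cardano_spec hp hi ht
  rw [ehat, hc]
  exact hx

theorem Regular.cardano_im (h : p.Regular) {γ ν : ℝ} (hp : p.Proper γ ν) {i : Fin M}
    (hi : (i : ℕ) < p.r) {t : ℝ} (ht : 0 < t) : (p.cardano γ ν i t).im = 0 := by
  obtain ⟨x, -, hc, -⟩ := h.cardano_spec hp hi ht
  rw [hc, Complex.ofReal_im]

theorem Regular.modeSlope_ehat (h : p.Regular) {γ ν : ℝ} (hp : p.Proper γ ν) {i : Fin M}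
    (hi : (i : ℕ) < p.r) {t : ℝ} (ht : 0 < t) :
    p.modeSlope γ ν i (p.ehat γ ν i t) t = 0 := by
  obtain ⟨x, -, hc, hx⟩ := h.cardano_spec hp hi ht
  rw [ehat, hc]
  exact hx

theorem Regular.price_nonneg (h : p.Regular) {ν : ℝ} (hν : 0 ≤ ν) : 0 ≤ p.price ν := by
  have := h.Tmax_pos
  have := Real.log_pos one_lt_two
  unfold price; positivity

theorem Regular.price_pos (h : p.Regular) {ν : ℝ} (hν : 0 < ν) : 0 < p.price ν := by
  have := h.Tmax_pos
  have := Real.log_pos one_lt_two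
  unfold price; positivity

theorem Regular.pos_or_pos (h : p.Regular) {γ ν : ℝ} (hp : p.Proper γ ν) : 0 < γ ∨ 0 < ν := by
  rcases hp.2.2 with h0 | h0
  · exact Or.inl h0
  · right
    refine lt_of_le_of_ne hp.2.1 ?_
    rintro rfl
    have h1 := h0 ⟨0, h.r_pos.trans_le h.r_le⟩ h.r_pos
    have h2 := one_div_pos.2 h.eta_pos
    simp only [coefB, zero_div, zero_mul, sub_zero] at h1
    linarith

/-- Both nonconstant terms are nondecreasing in the energy, and `pos_or_pos` gives one of them a
positive weight. Hence `ehat` is the only positive zero. -/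
theorem Regular.modeSlope_lt (h : p.Regular) {γ ν : ℝ} (hp : p.Proper γ ν) {i : Fin M}
    (hi : (i : ℕ) < p.r) {t : ℝ} (ht : 0 < t) {x y : ℝ} (hx : 0 < x) (hxy : x < y) :
    p.modeSlope γ ν i x t < p.modeSlope γ ν i y t := by
  have hy := hx.trans hxy
  have hn := h.noise_pos
  have hg := h.gain_pos hi
  have h1 : 1 / y ^ 2 < 1 / x ^ 2 := one_div_lt_one_div_of_lt (by positivity) (by gcongr)
  have h2 : p.gain i / (1 + p.gain i * y / t) < p.gain i / (1 + p.gain i * x / t) := by gcongr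
  have hγn : 0 ≤ γ * p.noise := mul_nonneg hp.1 hn.le
  have hpr := h.price_nonneg hp.2.1
  have h3 := mul_le_mul_of_nonneg_left h1.le hγn
  have h4 := mul_le_mul_of_nonneg_left h2.le hpr
  unfold modeSlope
  rcases h.pos_or_pos hp with h0 | h0
  · have := mul_lt_mul_of_pos_left h1 (mul_pos h0 hn)
    linarith
  · have := mul_lt_mul_of_pos_left h2 (h.price_pos h0)
    linarith

/-- Comparison with `ehat` becomes a sign condition on an explicit function, so continuity and
monotonicity in the duration need neither Cardano's formula nor implicit differentiation. -/
theorem Regular.lt_ehat_iff (h : p.Regular) {γ ν : ℝ} (hp : p.Proper γ ν) {i : Fin M}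
    (hi : (i : ℕ) < p.r) {t : ℝ} (ht : 0 < t) {x : ℝ} (hx : 0 < x) :
    x < p.ehat γ ν i t ↔ p.modeSlope γ ν i x t < 0 := by
  have h0 := h.modeSlope_ehat hp hi ht
  constructor
  · intro hlt
    exact h0 ▸ h.modeSlope_lt hp hi ht hx hlt
  · intro hlt
    by_contra! hle
    rcases hle.eq_or_lt with heq | hle
    · rw [heq] at h0; linarith
    · have := h.modeSlope_lt hp hi ht (h.ehat_pos hp hi ht) hle
      linarith

theorem Regular.ehat_lt_iff (h : p.Regular) {γ ν : ℝ} (hp : p.Proper γ ν) {i : Fin M}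
    (hi : (i : ℕ) < p.r) {t : ℝ} (ht : 0 < t) {x : ℝ} (hx : 0 < x) :
    p.ehat γ ν i t < x ↔ 0 < p.modeSlope γ ν i x t := by
  have h0 := h.modeSlope_ehat hp hi ht
  constructor
  · intro hlt
    exact h0 ▸ h.modeSlope_lt hp hi ht (h.ehat_pos hp hi ht) hlt
  · intro hlt
    by_contra! hle
    rcases hle.eq_or_lt with heq | hle
    · rw [← heq] at h0; linarith
    · have := (h.lt_ehat_iff hp hi ht hx).1 hle
      linarith

theorem Regular.eq_ehat (h : p.Regular) {γ ν : ℝ} (hp : p.Proper γ ν) {i : Fin M}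
    (hi : (i : ℕ) < p.r) {t : ℝ} (ht : 0 < t) {x : ℝ} (hx : 0 < x)
    (hx0 : p.modeSlope γ ν i x t = 0) : x = p.ehat γ ν i t := by
  rcases lt_trichotomy x (p.ehat γ ν i t) with h1 | h1 | h1
  · have := (h.lt_ehat_iff hp hi ht hx).1 h1
    linarith
  · exact h1
  · have := (h.ehat_lt_iff hp hi ht hx).1 h1
    linarith

theorem Regular.continuousAt_modeSlope {γ ν : ℝ} {i : Fin M} {t : ℝ} (ht : 0 < t) {x : ℝ}
    (hx : 0 < x) : ContinuousAt (fun t => p.modeSlope γ ν i x t) t := by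
  have hu := p.one_add_snr_pos i hx ht
  unfold modeSlope
  refine ContinuousAt.sub continuousAt_const (ContinuousAt.mul continuousAt_const ?_)
  refine ContinuousAt.div continuousAt_const ?_ hu.ne'
  exact continuousAt_const.add (continuousAt_const.div continuousAt_id ht.ne')

theorem Regular.continuousAt_ehat (h : p.Regular) {γ ν : ℝ} (hp : p.Proper γ ν) {i : Fin M}
    (hi : (i : ℕ) < p.r) {t : ℝ} (ht : 0 < t) : ContinuousAt (p.ehat γ ν i) t := by
  have hpos := h.ehat_pos hp hi ht
  have hev : ∀ᶠ t' in nhds t, 0 < t' := lt_mem_nhds ht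
  refine tendsto_order.2 ⟨fun a ha => ?_, fun b hb => ?_⟩
  -- The sign criterion applies only to positive energies, so `a` is raised to a positive number
  -- still below `ehat`.
  · have hx : 0 < max a (p.ehat γ ν i t / 2) := lt_max_of_lt_right (by positivity)
    have h1 := (h.lt_ehat_iff hp hi ht hx).1 (max_lt ha (by linarith))
    filter_upwards [hev, (continuousAt_modeSlope ht hx).eventually_lt_const h1] with t' ht' h2
    exact (le_max_left _ _).trans_lt ((h.lt_ehat_iff hp hi ht' hx).2 h2)
  · have hx : 0 < b := hpos.trans hb
    have h1 := (h.ehat_lt_iff hp hi ht hx).1 hb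
    filter_upwards [hev, (continuousAt_modeSlope ht hx).eventually_const_lt h1] with t' ht' h2
    exact (h.ehat_lt_iff hp hi ht' hx).2 h2

/-- The signal-to-noise ratio of an eigenmode does not increase with the duration. -/
theorem Regular.snr_le (h : p.Regular) {γ ν : ℝ} (hp : p.Proper γ ν) {i : Fin M}
    (hi : (i : ℕ) < p.r) {t s : ℝ} (ht : 0 < t) (hts : t < s) :
    p.gain i * p.ehat γ ν i s / s ≤ p.gain i * p.ehat γ ν i t / t ∧
      (0 < γ → p.gain i * p.ehat γ ν i s / s < p.gain i * p.ehat γ ν i t / t) := by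
  have hs := ht.trans hts
  have hg := h.gain_pos hi
  have hn := h.noise_pos
  have hx := h.ehat_pos hp hi ht
  have h0 := h.modeSlope_ehat hp hi ht
  set x := p.ehat γ ν i t with hxdef
  -- Scaling the energy with the duration preserves the signal-to-noise ratio, so only the term `-γ
  -- * noise / y²` of the slope changes, and it rises. The slope at `y` is thus nonnegative and
  -- `ehat` at `s` is at most `y`.
  set y := s / t * x with hy
  have hst : 1 < s / t := (one_lt_div ht).2 hts
  have hxy : x < y := by rw [hy]; nlinarith
  have hsnr : p.gain i * y / s = p.gain i * x / t := by rw [hy]; field_simp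
  have h1 : 1 / y ^ 2 < 1 / x ^ 2 := one_div_lt_one_div_of_lt (by positivity) (by gcongr)
  have hle : 0 ≤ p.modeSlope γ ν i y s := by
    have h3 := mul_le_mul_of_nonneg_left h1.le (mul_nonneg hp.1 hn.le)
    unfold modeSlope at h0 ⊢
    rw [hsnr]
    linarith
  rw [← hsnr]
  refine ⟨?_, fun hγ => ?_⟩
  · gcongr
    by_contra! hlt
    have := (h.lt_ehat_iff hp hi hs (hx.trans hxy)).1 hlt
    linarith
  · gcongr
    rw [h.ehat_lt_iff hp hi hs (hx.trans hxy)]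
    have h3 := mul_lt_mul_of_pos_left h1 (mul_pos hγ hn)
    unfold modeSlope at h0 ⊢
    rw [hsnr]
    linarith

/-! ### The equation for the duration -/

theorem Regular.snr_nonneg (h : p.Regular) {γ ν : ℝ} (hp : p.Proper γ ν) (i : Fin M) {t : ℝ}
    (ht : 0 < t) : 0 ≤ p.gain i * p.ehat γ ν i t / t := by
  rcases lt_or_ge (i : ℕ) p.r with hi | hi
  · have := h.gain_pos hi
    have := h.ehat_pos hp hi ht
    positivity
  · simp [h.gain_zero hi]

theorem Regular.tauLHS_monotoneOn (h : p.Regular) {γ ν : ℝ} (hp : p.Proper γ ν) :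
    MonotoneOn (p.tauLHS γ ν) (Set.Ioi 0) := by
  intro t ht s hs hts
  rcases hts.eq_or_lt with rfl | hts
  · rfl
  rw [h.tauLHS_eq, h.tauLHS_eq]
  have h1 : 0 ≤ ν / p.Tmax := div_nonneg hp.2.1 h.Tmax_pos.le
  gcongr with i
  rcases lt_or_ge (i : ℕ) p.r with hi | hi
  · exact rateSlope_strictMonoOn.monotoneOn (h.snr_nonneg hp i hs) (h.snr_nonneg hp i ht)
      (h.snr_le hp hi ht hts).1
  · simp [h.gain_zero hi]

theorem Regular.tauLHS_strictMonoOn (h : p.Regular) {γ ν : ℝ} (hp : p.Proper γ ν) (hγ : 0 < γ)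
    (hν : 0 < ν) : StrictMonoOn (p.tauLHS γ ν) (Set.Ioi 0) := by
  intro t ht s hs hts
  rw [h.tauLHS_eq, h.tauLHS_eq]
  have h1 : 0 < ν / p.Tmax := div_pos hν h.Tmax_pos
  have key : ∀ i : Fin M, (i : ℕ) < p.r → rateSlope (p.gain i * p.ehat γ ν i s / s) <
      rateSlope (p.gain i * p.ehat γ ν i t / t) := fun i hi =>
    rateSlope_strictMonoOn (h.snr_nonneg hp i hs) (h.snr_nonneg hp i ht)
      ((h.snr_le hp hi ht hts).2 hγ)
  gcongr ?_ - _ * ?_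
  refine Finset.sum_lt_sum (fun i _ => ?_)
    ⟨⟨0, h.r_pos.trans_le h.r_le⟩, Finset.mem_univ _, key _ h.r_pos⟩
  rcases lt_or_ge (i : ℕ) p.r with hi | hi
  · exact (key i hi).le
  · simp [h.gain_zero hi]

theorem Regular.tauLHS_continuousOn (h : p.Regular) {γ ν : ℝ} (hp : p.Proper γ ν) :
    ContinuousOn (p.tauLHS γ ν) (Set.Ioi 0) := by
  intro t ht
  refine ContinuousAt.continuousWithinAt ?_
  have heq : p.tauLHS γ ν = fun t => p.Pc - ν / p.Tmax *
      ∑ i, rateSlope (p.gain i * p.ehat γ ν i t / t) := funext fun t => h.tauLHS_eq γ ν t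
  rw [heq]
  refine continuousAt_const.sub (continuousAt_const.mul (tendsto_finsetSum _ fun i _ => ?_))
  rcases lt_or_ge (i : ℕ) p.r with hi | hi
  · have h1 : ContinuousAt (fun t => 1 + p.gain i * p.ehat γ ν i t / t) t :=
      continuousAt_const.add
        ((continuousAt_const.mul (h.continuousAt_ehat hp hi ht)).div continuousAt_id (ne_of_gt ht))
    have h2 := p.one_add_snr_pos i (h.ehat_pos hp hi ht) ht
    unfold rateSlope Real.logb
    exact ((((h1.log h2.ne').div_const _).add
      (continuousAt_const.mul (continuousAt_const.div h1 h2.ne'))).sub continuousAt_const)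
  · simp only [h.gain_zero hi, zero_mul, zero_div]
    exact tendsto_const_nhds

theorem Regular.tauSol_subsingleton (h : p.Regular) {γ ν : ℝ} (hp : p.Proper γ ν) (hγ : 0 < γ)
    (hν : 0 < ν) : (p.TauSol γ ν).Subsingleton := fun _ ha _ hb =>
  (h.tauLHS_strictMonoOn hp hγ hν).injOn ha.1 hb.1 (ha.2.trans hb.2.symm)

/-- Without a zero, the left-hand side of the equation for the duration has constant sign. -/
theorem Regular.tauLHS_sign (h : p.Regular) {γ ν : ℝ} (hp : p.Proper γ ν)
    (hsol : ∀ t, 0 < t → p.tauLHS γ ν t ≠ 0) {s : ℝ} (hs : 0 < s) {t : ℝ} (ht : 0 < t) :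
    0 < p.tauLHS γ ν s * p.tauLHS γ ν t := by
  by_contra! hle
  have hmem : (0 : ℝ) ∈ Set.uIcc (p.tauLHS γ ν s) (p.tauLHS γ ν t) := by
    rw [Set.mem_uIcc]
    rcases mul_nonpos_iff.1 hle with h1 | h1
    · exact Or.inr ⟨h1.2, h1.1⟩
    · exact Or.inl h1
  have hsub : Set.uIcc s t ⊆ Set.Ioi 0 := fun x hx => (lt_min hs ht).trans_le hx.1
  obtain ⟨x, hx, hx0⟩ := intermediate_value_uIcc ((h.tauLHS_continuousOn hp).mono hsub) hmem
  exact hsol x (hsub hx) hx0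

/-- A duration in `[Tmin, Tmax]` that satisfies the first-order conditions is a clipped solution. -/
theorem Regular.isClippedSol_of_sign (h : p.Regular) {γ ν : ℝ} (hp : p.Proper γ ν) {τ : ℝ}
    (h1 : p.Tmin ≤ τ) (h2 : τ ≤ p.Tmax) (hposi : 0 < p.tauLHS γ ν τ → τ = p.Tmin)
    (hnega : p.tauLHS γ ν τ < 0 → τ = p.Tmax) : p.IsClippedSol γ ν τ := by
  have hτ := h.Tmin_pos.trans_le h1
  by_cases hsol : ∃ t, 0 < t ∧ p.tauLHS γ ν t = 0
  · left
    obtain ⟨t, ht, ht0⟩ := hsol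
    rcases lt_trichotomy (p.tauLHS γ ν τ) 0 with h3 | h3 | h3
    · refine ⟨t, ⟨ht, ht0⟩, ?_⟩
      -- By monotonicity a zero lies to the right of a point where the left-hand side is negative;
      -- as `τ = Tmax` there, clipping the zero returns `τ`.
      have hlt : τ ≤ t := by
        by_contra! hlt
        have := h.tauLHS_monotoneOn hp ht hτ hlt.le
        linarith
      rw [hnega h3] at hlt ⊢
      rw [max_eq_left (h.Tmin_le.trans hlt), min_eq_right hlt]
    · exact ⟨τ, ⟨hτ, h3⟩, by rw [max_eq_left h1, min_eq_left h2]⟩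
    · refine ⟨t, ⟨ht, ht0⟩, ?_⟩
      have hlt : t ≤ τ := by
        by_contra! hlt
        have := h.tauLHS_monotoneOn hp hτ ht hlt.le
        linarith
      rw [hposi h3] at hlt ⊢
      rw [max_eq_right hlt, min_eq_left h.Tmin_le]
  · right
    push Not at hsol
    rcases lt_or_gt_of_ne (hsol τ hτ) with h3 | h3
    · exact Or.inl ⟨fun t ht => (neg_iff_neg_of_mul_pos (h.tauLHS_sign hp hsol hτ ht)).1 h3,
        hnega h3⟩
    · exact Or.inr ⟨fun t ht => (pos_iff_pos_of_mul_pos (h.tauLHS_sign hp hsol hτ ht)).1 h3,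
        hposi h3⟩

theorem IsClippedSol.eq_of_subsingleton {γ ν τ τ' : ℝ} (hsub : (p.TauSol γ ν).Subsingleton)
    (h1 : p.IsClippedSol γ ν τ) (h2 : p.IsClippedSol γ ν τ') : τ = τ' := by
  rcases h1 with ⟨t, ht, rfl⟩ | ⟨hs, rfl⟩ | ⟨hs, rfl⟩ <;>
    rcases h2 with ⟨t', ht', rfl⟩ | ⟨hs', rfl⟩ | ⟨hs', rfl⟩
  · rw [hsub ht ht']
  · exact absurd ht.2 (hs' t ht.1).ne
  · exact absurd ht.2 (hs' t ht.1).ne'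
  · exact absurd ht'.2 (hs t' ht'.1).ne
  · rfl
  · exact absurd (hs 1 one_pos) (hs' 1 one_pos).not_gt
  · exact absurd ht'.2 (hs t' ht'.1).ne'
  · exact absurd (hs 1 one_pos) (hs' 1 one_pos).not_gt
  · rfl

end ISACParams

namespace ISACParams

variable {M : ℕ} {p : ISACParams M}

/-! ### Existence of optimal power allocations -/

/-- The Slater point: a large energy common to all modes sends the CRB to zero, while the first mode
alone sends the rate to infinity. -/
theorem Regular.exists_strictly_feasible (h : p.Regular) :
    ∃ e : Fin M → ℝ, p.InDomain e p.Tmin ∧ p.crb e < p.Gam ∧ p.R < p.rate e p.Tmin := by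
  have hT := h.Tmin_pos
  have hTm := h.Tmax_pos
  set i₀ : Fin M := ⟨0, h.r_pos.trans_le h.r_le⟩
  have hg : 0 < p.gain i₀ := h.gain_pos h.r_pos
  have h1 : Filter.Tendsto (fun x : ℝ => p.crb fun _ : Fin M => x) Filter.atTop (nhds 0) := by
    have : (fun x : ℝ => p.crb fun _ : Fin M => x) = fun x => p.noise * M * x⁻¹ := by
      funext x
      simp [crb, noise]
      ring
    rw [this]
    simpa using tendsto_inv_atTop_zero.const_mul (p.noise * M)
  have h2 : Filter.Tendsto (fun x : ℝ => p.Tmin / p.Tmax *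
      (Real.log (1 + p.gain i₀ / p.Tmin * x) / Real.log 2)) Filter.atTop Filter.atTop := by
    refine Filter.Tendsto.const_mul_atTop (div_pos hT hTm) ?_
    refine Filter.Tendsto.atTop_div_const (Real.log_pos one_lt_two) ?_
    refine Real.tendsto_log_atTop.comp ?_
    exact Filter.tendsto_atTop_add_const_left _ _
      (Filter.tendsto_id.const_mul_atTop (div_pos hg hT))
  obtain ⟨x, hx0, hx1, hx2⟩ := ((Filter.eventually_gt_atTop 0).and
    ((h1.eventually_lt_const h.Gam_pos).and (h2.eventually_gt_atTop p.R))).exists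
  refine ⟨fun _ => x, ⟨fun _ => hx0, le_rfl, h.Tmin_le⟩, hx1, hx2.trans_le ?_⟩
  rw [h.rate_eq]
  gcongr
  have h3 : Real.log (1 + p.gain i₀ / p.Tmin * x) / Real.log 2 =
      Real.logb 2 (1 + p.gain i₀ * x / p.Tmin) := by
    rw [Real.logb, div_mul_eq_mul_div]
  rw [h3]
  refine Finset.single_le_sum (f := fun i => Real.logb 2 (1 + p.gain i * x / p.Tmin))
    (fun i _ => ?_) (Finset.mem_univ i₀)
  have := p.gain_nonneg i
  refine Real.logb_nonneg one_lt_two ?_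
  have : 0 ≤ p.gain i * x / p.Tmin := by positivity
  linarith

/-- Keeps feasible energies away from the singularity of `1 / e i`, as compactness requires. -/
theorem Regular.le_of_crb_le (h : p.Regular) {e : Fin M → ℝ} (he : ∀ i, 0 < e i)
    (hc : p.crb e ≤ p.Gam) (i : Fin M) : p.noise / p.Gam ≤ e i := by
  have hn := h.noise_pos
  have h1 : 1 / e i ≤ ∑ i, 1 / e i :=
    Finset.single_le_sum (f := fun i => 1 / e i) (fun j _ => (one_div_pos.2 (he j)).le)
      (Finset.mem_univ i)
  have h2 : p.noise * (1 / e i) ≤ p.Gam := (mul_le_mul_of_nonneg_left h1 hn.le).trans hc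
  rw [mul_one_div, div_le_iff₀ (he i)] at h2
  rw [div_le_iff₀ h.Gam_pos]
  linarith

theorem Regular.le_of_energy_le (h : p.Regular) {e : Fin M → ℝ} (he : ∀ i, 0 < e i) {τ E : ℝ}
    (hτ : 0 ≤ τ) (hE : p.energy e τ ≤ E) (i : Fin M) : e i ≤ p.eta * E := by
  have h1 : e i ≤ ∑ i, e i :=
    Finset.single_le_sum (fun j _ => (he j).le) (Finset.mem_univ i)
  have h2 := mul_nonneg h.Pc_nonneg hτ
  have h3 : 1 / p.eta * e i ≤ E :=
    (mul_le_mul_of_nonneg_left h1 (one_div_pos.2 h.eta_pos).le).trans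
      (by unfold energy at hE; linarith)
  rw [one_div_mul_eq_div, div_le_iff₀ h.eta_pos] at h3
  linarith

theorem Regular.exists_optimal (h : p.Regular) : ∃ e τ, p.Optimal e τ := by
  obtain ⟨e₀, hd₀, hc₀, hr₀⟩ := h.exists_strictly_feasible
  have hTm := h.Tmax_pos
  have hlow : 0 < p.noise / p.Gam := div_pos h.noise_pos h.Gam_pos
  set E := p.energy e₀ p.Tmin with hE
  -- This box contains every feasible point no costlier than the Slater point, and the constraint
  -- functions are continuous on it.
  set K : Set ((Fin M → ℝ) × ℝ) :=
    (Set.univ.pi fun _ => Set.Icc (p.noise / p.Gam) (p.eta * E)) ×ˢ Set.Icc p.Tmin p.Tmax with hK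
  have hKc : IsCompact K := (isCompact_univ_pi fun _ => isCompact_Icc).prod isCompact_Icc
  have hKe : ∀ x ∈ K, ∀ i, 0 < x.1 i := fun x hx i =>
    hlow.trans_le (hx.1 i (Set.mem_univ i)).1
  have hKτ : ∀ x ∈ K, 0 < x.2 := fun x hx => h.Tmin_pos.trans_le hx.2.1
  have hcrb : ContinuousOn (fun x : (Fin M → ℝ) × ℝ => p.crb x.1) K := by
    unfold crb
    refine continuousOn_const.mul (continuousOn_finsetSum _ fun i _ => ?_)
    exact continuousOn_const.div (by fun_prop) fun x hx => (hKe x hx i).ne'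
  have hrate : ContinuousOn (fun x : (Fin M → ℝ) × ℝ => p.rate x.1 x.2) K := by
    simp only [h.rate_eq, Real.logb]
    refine ContinuousOn.mul (by fun_prop) (continuousOn_finsetSum _ fun i _ => ?_)
    refine ContinuousOn.div_const (ContinuousOn.log ?_ fun x hx =>
      (p.one_add_snr_pos i (hKe x hx i) (hKτ x hx)).ne') _
    exact continuousOn_const.add (ContinuousOn.div (by fun_prop) (by fun_prop)
      fun x hx => (hKτ x hx).ne')
  set K' : Set ((Fin M → ℝ) × ℝ) :=
    (K ∩ (fun x => p.crb x.1) ⁻¹' Set.Iic p.Gam) ∩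
      (K ∩ (fun x => p.rate x.1 x.2) ⁻¹' Set.Ici p.R) with hK'
  have hK'c : IsCompact K' := hKc.of_isClosed_subset
    ((hcrb.preimage_isClosed_of_isClosed hKc.isClosed isClosed_Iic).inter
      (hrate.preimage_isClosed_of_isClosed hKc.isClosed isClosed_Ici)) fun x hx => hx.1.1
  have hmem : ∀ e τ, p.Feasible e τ → p.energy e τ ≤ E → (e, τ) ∈ K' := by
    intro e τ hf he
    have hx : (e, τ) ∈ K := ⟨fun i _ => ⟨h.le_of_crb_le hf.1.1 hf.2.1 i,
      h.le_of_energy_le hf.1.1 (h.Tmin_pos.le.trans hf.1.2.1) he i⟩, hf.1.2⟩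
    exact ⟨⟨hx, hf.2.1⟩, hx, hf.2.2⟩
  have h₀ : (e₀, p.Tmin) ∈ K' := hmem _ _ ⟨hd₀, hc₀.le, hr₀.le⟩ le_rfl
  have hen : ContinuousOn (fun x : (Fin M → ℝ) × ℝ => p.energy x.1 x.2) K' := by
    unfold energy
    fun_prop
  obtain ⟨x, hx, hmin⟩ := hK'c.exists_isMinOn ⟨_, h₀⟩ hen
  refine ⟨x.1, x.2, ⟨⟨hKe x hx.1.1, hx.1.1.2⟩, hx.1.2, hx.2.2⟩, fun e' τ' hf => ?_⟩
  rcases le_or_gt (p.energy e' τ') E with hle | hlt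
  · exact hmin (hmem e' τ' hf hle)
  · exact (hmin h₀).trans hlt.le

/-! ### Strong duality -/

theorem one_div_convex {a b x y : ℝ} (hx : 0 < x) (hy : 0 < y) (ha : 0 ≤ a) (hb : 0 ≤ b)
    (hab : a + b = 1) : 1 / (a * x + b * y) ≤ a * (1 / x) + b * (1 / y) := by
  have := (convexOn_zpow (𝕜 := ℝ) (-1)).2 (Set.mem_Ioi.2 hx) (Set.mem_Ioi.2 hy) ha hb hab
  simpa using this

/-- Jensen for the logarithm with weights `a s / (a s + b t)` and `b t / (a s + b t)`, which average
the two ratios to that of the averaged point. -/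
theorem logb_perspective_concave {g a b x y s t : ℝ} (hg : 0 ≤ g) (hx : 0 < x) (hy : 0 < y)
    (hs : 0 < s) (ht : 0 < t) (ha : 0 ≤ a) (hb : 0 ≤ b) (hab : a + b = 1) :
    a * (s * Real.logb 2 (1 + g * x / s)) + b * (t * Real.logb 2 (1 + g * y / t)) ≤
      (a * s + b * t) * Real.logb 2 (1 + g * (a * x + b * y) / (a * s + b * t)) := by
  have hT : 0 < a * s + b * t := by
    rcases ha.eq_or_lt with rfl | ha
    · have : b = 1 := by linarith
      subst this; linarith
    · positivity
  have h1 := strictConcaveOn_log_Ioi.concaveOn.2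
    (Set.mem_Ioi.2 (by positivity : 0 < 1 + g * x / s))
    (Set.mem_Ioi.2 (by positivity : 0 < 1 + g * y / t))
    (by positivity : 0 ≤ a * s / (a * s + b * t)) (by positivity : 0 ≤ b * t / (a * s + b * t))
    (by field_simp)
  simp only [smul_eq_mul] at h1
  have h2 : a * s / (a * s + b * t) * (1 + g * x / s) + b * t / (a * s + b * t) * (1 + g * y / t)
      = 1 + g * (a * x + b * y) / (a * s + b * t) := by
    field_simp
    ring
  rw [h2] at h1
  have h3 := mul_le_mul_of_nonneg_left h1
    (div_pos hT (Real.log_pos one_lt_two)).le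
  unfold Real.logb
  calc _ = (a * s + b * t) / Real.log 2 * (a * s / (a * s + b * t) * Real.log (1 + g * x / s) +
        b * t / (a * s + b * t) * Real.log (1 + g * y / t)) := by
          field_simp
    _ ≤ _ := h3
    _ = _ := by ring

theorem InDomain.convex {e e' : Fin M → ℝ} {τ τ' a b : ℝ}
    (h1 : p.InDomain e τ) (h2 : p.InDomain e' τ') (ha : 0 ≤ a) (hb : 0 ≤ b) (hab : a + b = 1) :
    p.InDomain (fun i => a * e i + b * e' i) (a * τ + b * τ') := by
  have h3 := convex_Icc p.Tmin p.Tmax h1.2 h2.2 ha hb hab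
  exact ⟨fun i => convex_Ioi (0 : ℝ) (h1.1 i) (h2.1 i) ha hb hab, h3⟩

theorem Regular.crb_convex (h : p.Regular) {e e' : Fin M → ℝ} {a b : ℝ}
    (h1 : ∀ i, 0 < e i) (h2 : ∀ i, 0 < e' i) (ha : 0 ≤ a) (hb : 0 ≤ b) (hab : a + b = 1) :
    p.crb (fun i => a * e i + b * e' i) ≤ a * p.crb e + b * p.crb e' := by
  have h3 : ∑ i, 1 / (a * e i + b * e' i) ≤ ∑ i, (a * (1 / e i) + b * (1 / e' i)) :=
    Finset.sum_le_sum fun i _ => one_div_convex (h1 i) (h2 i) ha hb hab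
  rw [Finset.sum_add_distrib, ← Finset.mul_sum, ← Finset.mul_sum] at h3
  have h4 := mul_le_mul_of_nonneg_left h3 h.noise_pos.le
  unfold crb
  unfold noise at h4
  linarith

theorem Regular.rate_concave (h : p.Regular) {e e' : Fin M → ℝ} {τ τ' a b : ℝ}
    (h1 : p.InDomain e τ) (h2 : p.InDomain e' τ') (ha : 0 ≤ a) (hb : 0 ≤ b) (hab : a + b = 1) :
    a * p.rate e τ + b * p.rate e' τ' ≤
      p.rate (fun i => a * e i + b * e' i) (a * τ + b * τ') := by
  have h3 := Finset.sum_le_sum fun (i : Fin M) (_ : i ∈ Finset.univ) =>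
    logb_perspective_concave (p.gain_nonneg i) (h1.1 i) (h2.1 i)
      (h.Tmin_pos.trans_le h1.2.1) (h.Tmin_pos.trans_le h2.2.1) ha hb hab
  simp only [Finset.sum_add_distrib, ← Finset.mul_sum] at h3
  have h4 := mul_le_mul_of_nonneg_left h3 (one_div_pos.2 h.Tmax_pos).le
  simp only [h.rate_eq]
  calc _ = _ := by ring
    _ ≤ _ := h4
    _ = _ := by ring

theorem lagrangian_eq_energy (e : Fin M → ℝ) (τ γ ν : ℝ) : p.lagrangian e τ γ ν =
    p.energy e τ + γ * (p.crb e - p.Gam) + ν * (p.R - p.rate e τ) := by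
  unfold lagrangian energy
  ring

theorem nonneg_of_forall_add_mul_pos {a c : ℝ} (h : ∀ t : ℝ, 0 ≤ t → 0 < c + a * t) : 0 ≤ a := by
  by_contra! ha
  have h0 := h 0 le_rfl
  have h1 := h (c / -a) (div_nonneg (by linarith) (by linarith))
  have h2 : a * (c / -a) = -c := by
    have := ha.ne
    field_simp
  linarith

/-- `A` collects the triples strictly above some attainable (CRB residual, rate residual, energy
excess). It is convex, open because of the strict inequalities, and misses the origin because `E` is
a lower bound. A separating functional, normalized in the energy direction, supplies the
multipliers. -/
theorem Regular.exists_multipliers (h : p.Regular) {E : ℝ}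
    (hE : ∀ e τ, p.Feasible e τ → E ≤ p.energy e τ) :
    ∃ γ ν, 0 ≤ γ ∧ 0 ≤ ν ∧ ∀ e τ, p.InDomain e τ → E ≤ p.lagrangian e τ γ ν := by
  obtain ⟨e₀, hd₀, hc₀, hr₀⟩ := h.exists_strictly_feasible
  set A : Set (ℝ × ℝ × ℝ) := {x | ∃ e τ, p.InDomain e τ ∧ p.crb e - p.Gam < x.1 ∧
    p.R - p.rate e τ < x.2.1 ∧ p.energy e τ - E < x.2.2} with hA
  have hconv : Convex ℝ A := by
    rintro x ⟨e, τ, hd, hx1, hx2, hx3⟩ y ⟨e', τ', hd', hy1, hy2, hy3⟩ a b ha hb hab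
    refine ⟨_, _, hd.convex hd' ha hb hab, ?_, ?_, ?_⟩
    · have h1 := h.crb_convex hd.1 hd'.1 ha hb hab
      have h2 := convex_Ioi (0 : ℝ) (sub_pos.2 hx1) (sub_pos.2 hy1) ha hb hab
      simp only [smul_eq_mul, Set.mem_Ioi, Prod.fst_add, Prod.smul_fst] at h2 ⊢
      linear_combination h1 + h2 + p.Gam * hab
    · have h1 := h.rate_concave hd hd' ha hb hab
      have h2 := convex_Ioi (0 : ℝ) (sub_pos.2 hx2) (sub_pos.2 hy2) ha hb hab
      simp only [smul_eq_mul, Set.mem_Ioi, Prod.fst_add, Prod.smul_fst, Prod.snd_add,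
        Prod.smul_snd] at h2 ⊢
      linear_combination h1 + h2 - p.R * hab
    · have h2 := convex_Ioi (0 : ℝ) (sub_pos.2 hx3) (sub_pos.2 hy3) ha hb hab
      simp only [smul_eq_mul, Set.mem_Ioi, Prod.smul_snd, Prod.snd_add] at h2 ⊢
      unfold energy at h2 ⊢
      rw [Finset.sum_add_distrib, ← Finset.mul_sum, ← Finset.mul_sum]
      linear_combination h2 + E * hab
  have hopen : IsOpen A := by
    have : A = ⋃ (e : Fin M → ℝ) (τ : ℝ) (_ : p.InDomain e τ),
        Set.Ioi (p.crb e - p.Gam) ×ˢ Set.Ioi (p.R - p.rate e τ) ×ˢ Set.Ioi (p.energy e τ - E) := by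
      ext x
      simp only [hA, Set.mem_ofPred_eq, Set.mem_iUnion, Set.mem_prod, Set.mem_Ioi, exists_prop]
    rw [this]
    exact isOpen_iUnion fun _ => isOpen_iUnion fun _ => isOpen_iUnion fun _ =>
      isOpen_Ioi.prod (isOpen_Ioi.prod isOpen_Ioi)
  have h0 : (0 : ℝ × ℝ × ℝ) ∉ A := by
    rintro ⟨e, τ, hd, h1, h2, h3⟩
    simp only [Prod.fst_zero, Prod.snd_zero] at h1 h2 h3
    have := hE e τ ⟨hd, by linarith, by linarith⟩
    linarith
  obtain ⟨f, hf⟩ := geometric_hahn_banach_open_point hconv hopen h0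
  rw [map_zero] at hf
  obtain ⟨α, β, δ, hfe⟩ : ∃ α β δ : ℝ, ∀ x y z, f (x, y, z) = -(α * x + β * y + δ * z) := by
    refine ⟨-f (1, 0, 0), -f (0, 1, 0), -f (0, 0, 1), fun x y z => ?_⟩
    have : ((x, y, z) : ℝ × ℝ × ℝ) = x • (1, 0, 0) + y • (0, 1, 0) + z • (0, 0, 1) := by
      simp
    rw [this]
    simp only [map_add, map_smul, smul_eq_mul]
    ring
  have hpos : ∀ e τ, p.InDomain e τ → ∀ x y z, p.crb e - p.Gam < x → p.R - p.rate e τ < y →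
      p.energy e τ - E < z → 0 < α * x + β * y + δ * z := by
    intro e τ hd x y z hx hy hz
    have h1 := hf (x, y, z) ⟨e, τ, hd, hx, hy, hz⟩
    rw [hfe] at h1
    linarith
  set z₀ := p.energy e₀ p.Tmin - E + 1 with hz₀
  -- `A` is closed under raising a coordinate, so the functional stays positive along such a ray
  -- from the Slater point.
  have hα : 0 ≤ α := nonneg_of_forall_add_mul_pos (c := α * 0 + β * 0 + δ * z₀) fun t ht => by
    have := hpos e₀ _ hd₀ t 0 z₀ (by linarith) (by linarith) (by linarith)
    linarith
  have hβ : 0 ≤ β := nonneg_of_forall_add_mul_pos (c := α * 0 + β * 0 + δ * z₀) fun t ht => by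
    have := hpos e₀ _ hd₀ 0 t z₀ (by linarith) (by linarith) (by linarith)
    linarith
  have hδ : 0 ≤ δ := nonneg_of_forall_add_mul_pos (c := α * 0 + β * 0 + δ * z₀) fun t ht => by
    have := hpos e₀ _ hd₀ 0 0 (z₀ + t) (by linarith) (by linarith) (by linarith)
    linarith
  -- Strict feasibility puts `(0, 0, z₀)` in `A`, where the functional equals `δ * z₀`.
  have hδ0 : 0 < δ := by
    refine lt_of_le_of_ne hδ fun h1 => ?_
    have h2 := hpos e₀ _ hd₀ 0 0 z₀ (by linarith) (by linarith) (by linarith)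
    simp [← h1] at h2
  have hle : ∀ e τ, p.InDomain e τ →
      0 ≤ α * (p.crb e - p.Gam) + β * (p.R - p.rate e τ) + δ * (p.energy e τ - E) := by
    intro e τ hd
    -- The attainable triple itself is not in `A`; it is approached by adding `ε / (α + β + δ)` to
    -- each coordinate.
    refine le_of_forall_pos_le_add fun ε hε => ?_
    have hs : 0 < α + β + δ := by linarith
    have hε' : 0 < ε / (α + β + δ) := div_pos hε hs
    have h1 := hpos e τ hd _ _ _ (lt_add_of_pos_right _ hε') (lt_add_of_pos_right _ hε')
      (lt_add_of_pos_right _ hε')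
    have h2 : (α + β + δ) * (ε / (α + β + δ)) = ε := mul_div_cancel₀ _ hs.ne'
    linarith
  refine ⟨α / δ, β / δ, by positivity, by positivity, fun e τ hd => ?_⟩
  have h1 := div_nonneg (hle e τ hd) hδ
  rw [lagrangian_eq_energy]
  have h2 : (α * (p.crb e - p.Gam) + β * (p.R - p.rate e τ) + δ * (p.energy e τ - E)) / δ =
      α / δ * (p.crb e - p.Gam) + β / δ * (p.R - p.rate e τ) + (p.energy e τ - E) := by
    field_simp
  linarith

theorem le_dualFun_iff {E γ ν : ℝ} :
    (E : EReal) ≤ p.dualFun γ ν ↔ ∀ e τ, p.InDomain e τ → E ≤ p.lagrangian e τ γ ν := by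
  simp [dualFun, le_iInf_iff, EReal.coe_le_coe_iff]

theorem Feasible.lagrangian_le {e : Fin M → ℝ} {τ γ ν : ℝ} (hf : p.Feasible e τ) (hγ : 0 ≤ γ)
    (hν : 0 ≤ ν) : p.lagrangian e τ γ ν ≤ p.energy e τ := by
  rw [lagrangian_eq_energy]
  have h1 := mul_nonneg hγ (sub_nonneg.2 hf.2.1)
  have h2 := mul_nonneg hν (sub_nonneg.2 hf.2.2)
  linarith

theorem Optimal.dualFun_le {e : Fin M → ℝ} {τ γ ν : ℝ} (ho : p.Optimal e τ) (hγ : 0 ≤ γ)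
    (hν : 0 ≤ ν) : p.dualFun γ ν ≤ (p.energy e τ : EReal) := by
  refine le_trans ?_ (EReal.coe_le_coe_iff.2 (ho.1.lagrangian_le hγ hν))
  exact iInf_le_of_le e (iInf_le_of_le τ (iInf_le _ ho.1.1))

theorem Regular.exists_dualOptimal (h : p.Regular) : ∃ γ ν, p.DualOptimal γ ν := by
  obtain ⟨e, τ, ho⟩ := h.exists_optimal
  obtain ⟨γ, ν, hγ, hν, hL⟩ := h.exists_multipliers ho.2
  exact ⟨γ, ν, hγ, hν, fun γ' ν' hγ' hν' =>
    (ho.dualFun_le hγ' hν').trans (le_dualFun_iff.2 hL)⟩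

/-- A dual optimum does at least as well as the multipliers from separation, so the gap is zero at
every dual optimum. -/
theorem Regular.energy_le_lagrangian (h : p.Regular) {γ ν : ℝ} (hdual : p.DualOptimal γ ν)
    {e : Fin M → ℝ} {τ : ℝ} (ho : p.Optimal e τ) {e' : Fin M → ℝ} {τ' : ℝ}
    (hd : p.InDomain e' τ') : p.energy e τ ≤ p.lagrangian e' τ' γ ν := by
  obtain ⟨γ', ν', hγ', hν', hL⟩ := h.exists_multipliers ho.2
  exact le_dualFun_iff.1 ((le_dualFun_iff.2 hL).trans (hdual.2.2 γ' ν' hγ' hν')) e' τ' hd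

/-- A primal optimal solution minimizes the Lagrangian at dual optimal multipliers. -/
theorem Regular.lagrangian_min (h : p.Regular) {γ ν : ℝ} (hdual : p.DualOptimal γ ν)
    {e : Fin M → ℝ} {τ : ℝ} (ho : p.Optimal e τ) {e' : Fin M → ℝ} {τ' : ℝ}
    (hd : p.InDomain e' τ') : p.lagrangian e τ γ ν ≤ p.lagrangian e' τ' γ ν :=
  (ho.1.lagrangian_le hdual.1 hdual.2.1).trans (h.energy_le_lagrangian hdual ho hd)

theorem Regular.complementary_slackness (h : p.Regular) {γ ν : ℝ} (hdual : p.DualOptimal γ ν)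
    {e : Fin M → ℝ} {τ : ℝ} (ho : p.Optimal e τ) :
    γ * (p.crb e - p.Gam) = 0 ∧ ν * (p.R - p.rate e τ) = 0 := by
  have h0 := h.energy_le_lagrangian hdual ho ho.1.1
  rw [lagrangian_eq_energy] at h0
  have h1 := mul_nonpos_of_nonneg_of_nonpos hdual.1 (sub_nonpos.2 ho.1.2.1)
  have h2 := mul_nonpos_of_nonneg_of_nonpos hdual.2.1 (sub_nonpos.2 ho.1.2.2)
  constructor <;> linarith

/-! ### First-order conditions -/

theorem Regular.modeCost_min (h : p.Regular) {γ ν : ℝ} (hdual : p.DualOptimal γ ν)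
    {e : Fin M → ℝ} {τ : ℝ} (ho : p.Optimal e τ) (i : Fin M) {x : ℝ} (hx : 0 < x) :
    p.modeCost γ ν i (e i) τ ≤ p.modeCost γ ν i x τ := by
  have hd : p.InDomain (Function.update e i x) τ := by
    refine ⟨fun j => ?_, ho.1.1.2⟩
    rcases eq_or_ne j i with rfl | hj
    · simpa using hx
    · simpa [hj] using ho.1.1.1 j
  have h1 := h.lagrangian_min hdual ho hd
  rw [h.lagrangian_eq, h.lagrangian_eq, ← Finset.add_sum_erase _ _ (Finset.mem_univ i),
    ← Finset.add_sum_erase _ _ (Finset.mem_univ i)] at h1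
  have h2 : ∑ j ∈ Finset.univ.erase i, p.modeCost γ ν j (Function.update e i x j) τ =
      ∑ j ∈ Finset.univ.erase i, p.modeCost γ ν j (e j) τ :=
    Finset.sum_congr rfl fun j hj => by rw [Function.update_of_ne (Finset.ne_of_mem_erase hj)]
  rw [h2, Function.update_self] at h1
  linarith

theorem Regular.modeSlope_eq_zero (h : p.Regular) {γ ν : ℝ} (hdual : p.DualOptimal γ ν)
    {e : Fin M → ℝ} {τ : ℝ} (ho : p.Optimal e τ) (i : Fin M) :
    p.modeSlope γ ν i (e i) τ = 0 := by
  have hτ : 0 < τ := h.Tmin_pos.trans_le ho.1.1.2.1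
  have hmin : IsLocalMin (fun x => p.modeCost γ ν i x τ) (e i) := by
    filter_upwards [lt_mem_nhds (ho.1.1.1 i)] with x hx
    exact h.modeCost_min hdual ho i hx
  exact hmin.hasDerivAt_eq_zero (hasDerivAt_modeCost γ ν i (ho.1.1.1 i) hτ)

/-- If `γ = 0`, stationarity reads `1 / η = price * gain / (1 + snr) < price * gain`, which is
`coefB < 0`. -/
theorem Regular.proper (h : p.Regular) {γ ν : ℝ} (hdual : p.DualOptimal γ ν) :
    p.Proper γ ν := by
  obtain ⟨e, τ, ho⟩ := h.exists_optimal
  refine ⟨hdual.1, hdual.2.1, ?_⟩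
  rcases hdual.1.eq_or_lt with rfl | hγ
  · right
    intro i hi
    have hτ : 0 < τ := h.Tmin_pos.trans_le ho.1.1.2.1
    have h0 := h.modeSlope_eq_zero hdual ho i
    have heta := one_div_pos.2 h.eta_pos
    have hg := h.gain_pos hi
    have he := ho.1.1.1 i
    simp only [modeSlope, zero_mul, sub_zero] at h0
    have hν : 0 < p.price ν := by
      refine lt_of_le_of_ne (h.price_nonneg hdual.2.1) fun h1 => ?_
      rw [← h1] at h0
      linarith
    have h2 : p.gain i / (1 + p.gain i * e i / τ) < p.gain i :=
      div_lt_self hg (by have : 0 < p.gain i * e i / τ := by positivity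
                         linarith)
    have h3 := mul_lt_mul_of_pos_left h2 hν
    change 1 / p.eta - p.price ν * p.gain i < 0
    linarith
  · exact Or.inl hγ

theorem Regular.stationary (h : p.Regular) {γ ν : ℝ} (hdual : p.DualOptimal γ ν)
    {e : Fin M → ℝ} {τ : ℝ} (ho : p.Optimal e τ) : p.Stationary γ ν e τ := by
  intro i _
  have h0 := h.modeSlope_eq_zero hdual ho i
  rw [snr_eq]
  unfold modeSlope noise price gain at h0
  unfold gain
  linear_combination h0

/-- Serves the one-sided first-order conditions on `[Tmin, Tmax]`; the bound `a` keeps the improved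
duration admissible. -/
theorem exists_lt_of_hasDerivAt_pos {f : ℝ → ℝ} {a x c : ℝ} (hf : HasDerivAt f c x) (hc : 0 < c)
    (hax : a < x) : ∃ y, a < y ∧ y < x ∧ f y < f x := by
  have h1 := (hasDerivAt_iff_tendsto_slope_left_right.1 hf).1.eventually_const_lt hc
  have h2 : ∀ᶠ y in nhdsWithin x (Set.Iio x), y ∈ Set.Ioo a x := Ioo_mem_nhdsLT hax
  obtain ⟨y, hy1, hy2⟩ := (h1.and h2).exists
  refine ⟨y, hy2.1, hy2.2, ?_⟩
  rw [slope_def_field] at hy1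
  rcases div_pos_iff.1 hy1 with h3 | h3 <;> linarith [hy2.2]

theorem exists_lt_of_hasDerivAt_neg {f : ℝ → ℝ} {b x c : ℝ} (hf : HasDerivAt f c x) (hc : c < 0)
    (hxb : x < b) : ∃ y, x < y ∧ y < b ∧ f y < f x := by
  have h1 : HasDerivAt f c (- -x) := by rwa [neg_neg]
  have h0 : HasDerivAt (fun y => f (-y)) (-c) (-x) :=
    (h1.comp (-x) (hasDerivAt_neg (-x))).congr_deriv (by ring)
  obtain ⟨y, hy1, hy2, hy3⟩ := exists_lt_of_hasDerivAt_pos h0 (by linarith) (neg_lt_neg hxb)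
  exact ⟨-y, by linarith, by linarith, by simpa using hy3⟩

theorem Regular.closedForm (h : p.Regular) {γ ν : ℝ} (hdual : p.DualOptimal γ ν)
    {e : Fin M → ℝ} {τ : ℝ} (ho : p.Optimal e τ) : p.ClosedForm γ ν e τ := by
  have hp := h.proper hdual
  have hd := ho.1.1
  have hτ : 0 < τ := h.Tmin_pos.trans_le hd.2.1
  have hehat : ∀ i : Fin M, (i : ℕ) < p.r → e i = p.ehat γ ν i τ := fun i hi =>
    h.eq_ehat hp hi hτ (hd.1 i) (h.modeSlope_eq_zero hdual ho i)
  refine ⟨fun i hi => ?_, hehat, ?_⟩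
  · have h0 := h.modeSlope_eq_zero hdual ho i
    have he := hd.1 i
    have heta := h.eta_pos
    rw [eq_comm, Real.sqrt_eq_iff_mul_self_eq_of_pos he]
    simp only [modeSlope, h.gain_zero hi, zero_div, mul_zero, sub_zero] at h0
    field_simp at h0
    unfold noise at h0
    linear_combination h0
  -- The energies stay fixed in this derivative; it equals `tauLHS` because they agree with `ehat`
  -- at the point `τ`.
  · have hder : HasDerivAt (fun t => p.lagrangian e t γ ν) (p.tauLHS γ ν τ) τ := by
      simp only [h.lagrangian_eq]
      have h1 := HasDerivAt.fun_sum fun (i : Fin M) (_ : i ∈ Finset.univ) =>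
        hasDerivAt_modeCost_tau (p := p) γ ν i (hd.1 i) hτ
      have h2 := ((((hasDerivAt_id τ).const_mul p.Pc).sub_const (γ * p.Gam)).add_const (ν * p.R))
      refine (h1.add h2).congr_deriv ?_
      rw [h.tauLHS_eq, Finset.sum_neg_distrib, ← Finset.mul_sum]
      have h3 : ∀ i, rateSlope (p.gain i * e i / τ) = rateSlope (p.gain i * p.ehat γ ν i τ / τ) := by
        intro i
        rcases lt_or_ge (i : ℕ) p.r with hi | hi
        · rw [hehat i hi]
        · simp [h.gain_zero hi]
      simp only [h3]
      ring
    refine h.isClippedSol_of_sign hp hd.2.1 hd.2.2 (fun hg => ?_) fun hg => ?_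
    · by_contra hne
      obtain ⟨y, hy1, hy2, hy3⟩ :=
        exists_lt_of_hasDerivAt_pos hder hg (lt_of_le_of_ne hd.2.1 (Ne.symm hne))
      have := h.lagrangian_min hdual ho ⟨hd.1, hy1.le, hy2.le.trans hd.2.2⟩
      linarith
    · by_contra hne
      obtain ⟨y, hy1, hy2, hy3⟩ :=
        exists_lt_of_hasDerivAt_neg hder hg (lt_of_le_of_ne hd.2.2 hne)
      have := h.lagrangian_min hdual ho ⟨hd.1, hd.2.1.trans hy1.le, hy2.le⟩
      linarith

/-- No sufficiency of first-order conditions is needed: the closed form determines one point, and an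
existing optimum has that form. -/
theorem Regular.optimal_of_closedForm (h : p.Regular) {γ ν : ℝ} (hdual : p.DualOptimal γ ν)
    (hsub : (p.TauSol γ ν).Subsingleton) {e : Fin M → ℝ} {τ : ℝ} (hcf : p.ClosedForm γ ν e τ) :
    p.Optimal e τ := by
  obtain ⟨e', τ', ho⟩ := h.exists_optimal
  have hcf' := h.closedForm hdual ho
  obtain rfl : τ = τ' := hcf.2.2.eq_of_subsingleton hsub hcf'.2.2
  have : e = e' := by
    funext i
    rcases lt_or_ge (i : ℕ) p.r with hi | hi
    · rw [hcf.2.1 i hi, hcf'.2.1 i hi]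
    · rw [hcf.1 i hi, hcf'.1 i hi]
  rwa [this]

/-! ### Active constraints -/

/-- A mode of zero gain affects only energy and CRB. With `γ = 0` its slope would be `1 / η ≠ 0`. -/
theorem Regular.crb_eq_of_lt (h : p.Regular) {e : Fin M → ℝ} {τ : ℝ} (ho : p.Optimal e τ)
    (hr : p.r < M) : p.crb e = p.Gam := by
  obtain ⟨γ, ν, hdual⟩ := h.exists_dualOptimal
  rcases mul_eq_zero.1 (h.complementary_slackness hdual ho).1 with hγ | hc
  · have h0 := h.modeSlope_eq_zero hdual ho ⟨p.r, hr⟩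
    have h1 := one_div_pos.2 h.eta_pos
    simp only [modeSlope, hγ, h.gain_zero (i := ⟨p.r, hr⟩) le_rfl, zero_mul, zero_div, mul_zero,
      sub_zero] at h0
    linarith
  · linarith

theorem Regular.crb_eq_or_rate_eq (h : p.Regular) {e : Fin M → ℝ} {τ : ℝ} (ho : p.Optimal e τ) :
    p.crb e = p.Gam ∨ p.rate e τ = p.R := by
  obtain ⟨γ, ν, hdual⟩ := h.exists_dualOptimal
  obtain ⟨h1, h2⟩ := h.complementary_slackness hdual ho
  rcases h.pos_or_pos (h.proper hdual) with h0 | h0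
  · left
    linarith [(mul_eq_zero.1 h1).resolve_left h0.ne']
  · right
    linarith [(mul_eq_zero.1 h2).resolve_left h0.ne']

end ISACParams

/-! ### Inequalities for positive definite matrices -/

namespace Matrix.PosDef

variable {n : Type*} {A : Matrix n n ℂ}

theorem coe_re_diag (hA : A.PosDef) (i : n) : (((A i i).re : ℝ) : ℂ) = A i i :=
  hA.isHermitian.coe_re_apply_self i

theorem re_diag_pos (hA : A.PosDef) (i : n) : 0 < (A i i).re :=
  (Complex.pos_iff.1 hA.diag_pos).1

variable [Fintype n] [DecidableEq n]

theorem eq_zero_of_conj_eq_zero (hA : A.PosDef) {X : Matrix n n ℂ} (hX : Xᴴ * A * X = 0) :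
    X = 0 := by
  refine Matrix.ext_of_mulVec_single fun i => ?_
  rw [zero_mulVec]
  by_contra hne
  have h1 := hA.dotProduct_mulVec_pos hne
  rw [star_mulVec, ← dotProduct_mulVec, mulVec_mulVec, mulVec_mulVec, hX, zero_mulVec,
    dotProduct_zero] at h1
  exact h1.false

/-- With `D` the inverse of the diagonal part and `X = A⁻¹ - D`, the trace of `Xᴴ * A * X ⪰ 0` is
exactly the difference of the two sides. It vanishes only for `X = 0`, that is, when `A` is
diagonal. -/
theorem sum_one_div_diag_le_trace_inv (hA : A.PosDef) :
    ∑ i, 1 / (A i i).re ≤ (A⁻¹).trace.re ∧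
      (∑ i, 1 / (A i i).re = (A⁻¹).trace.re → A.IsDiag) := by
  set D : Matrix n n ℂ := diagonal fun i => 1 / A i i with hD
  have hDH : Dᴴ = D := by
    rw [hD, diagonal_conjTranspose]
    congr 1
    funext i
    rw [Pi.star_apply, ← hA.coe_re_diag i]
    simp
  have hinv : A⁻¹ * A = 1 := nonsing_inv_mul A ((isUnit_iff_isUnit_det A).1 hA.isUnit)
  have hinv' : A * A⁻¹ = 1 := mul_nonsing_inv A ((isUnit_iff_isUnit_det A).1 hA.isUnit)
  set X := A⁻¹ - D with hX
  have hXH : Xᴴ = X := by rw [hX, conjTranspose_sub, hA.inv.isHermitian.eq, hDH]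
  have hP : (Xᴴ * A * X).PosSemidef := hA.posSemidef.conjTranspose_mul_mul_same X
  have hexp : Xᴴ * A * X = A⁻¹ - D - (D - D * A * D) := by
    rw [hXH, hX, Matrix.sub_mul, hinv, Matrix.sub_mul, Matrix.one_mul, Matrix.mul_sub,
      Matrix.mul_assoc D A A⁻¹, hinv', Matrix.mul_one]
  have htr : (Xᴴ * A * X).trace = (A⁻¹).trace - ∑ i, 1 / A i i := by
    have h1 : (D * A * D).trace = D.trace := by
      simp only [trace, diag_apply, hD, mul_diagonal, diagonal_mul, diagonal_apply_eq]
      refine Finset.sum_congr rfl fun i _ => ?_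
      have : A i i ≠ 0 := hA.diag_pos.ne'
      field_simp
    rw [hexp, trace_sub, trace_sub, trace_sub, h1, sub_self, sub_zero, hD, trace_diagonal]
  have hsum : (∑ i, 1 / A i i) = ((∑ i, 1 / (A i i).re : ℝ) : ℂ) := by
    push_cast
    exact Finset.sum_congr rfl fun i _ => by rw [hA.coe_re_diag]
  have hnn := Complex.nonneg_iff.1 hP.trace_nonneg
  rw [htr, hsum, Complex.sub_re, Complex.ofReal_re] at hnn
  refine ⟨by linarith [hnn.1], fun heq => ?_⟩
  have h0 : (Xᴴ * A * X).trace = 0 := by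
    rw [htr, hsum]
    refine Complex.ext ?_ ?_
    · rw [Complex.sub_re, Complex.ofReal_re, heq, sub_self, Complex.zero_re]
    · rw [← hsum, ← htr]
      exact (Complex.nonneg_iff.1 hP.trace_nonneg).2.symm
  have hX0 : X = 0 := hA.eq_zero_of_conj_eq_zero (hP.trace_eq_zero_iff.1 h0)
  have hAD : A * D = 1 := by rw [← hinv', sub_eq_zero.1 hX0]
  intro i j hij
  have h1 := congrFun (congrFun hAD i) j
  rw [hD, mul_diagonal, one_apply_ne hij] at h1
  exact (mul_eq_zero.1 h1).resolve_right (one_div_ne_zero hA.diag_pos.ne')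

/-- **Hadamard's inequality** for a positive definite matrix with unit diagonal. -/
theorem det_le_one_of_diag_eq_one (hA : A.PosDef) (hd : ∀ i, A i i = 1) :
    A.det.re ≤ 1 ∧ (A.det.re = 1 → A = 1) := by
  set μ := hA.isHermitian.eigenvalues with hμ
  have hμ0 : ∀ i, 0 < μ i := hA.eigenvalues_pos
  have hdet : A.det.re = ∏ i, μ i := by
    rw [hA.isHermitian.det_eq_prod_eigenvalues]
    exact_mod_cast rfl
  have hsum : ∑ i, (μ i - 1) = 0 := by
    have h1 := hA.isHermitian.trace_eq_sum_eigenvalues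
    have h2 : A.trace = ((Fintype.card n : ℝ) : ℂ) := by simp [trace, hd]
    rw [h2] at h1
    have h3 : (Fintype.card n : ℝ) = ∑ i, μ i := Complex.ofReal_injective (h1.trans (Complex.ofReal_sum _ _).symm)
    rw [Finset.sum_sub_distrib, ← h3]
    simp
  -- AM–GM for eigenvalues of mean one, through `μ ≤ exp (μ - 1)` with equality only at `μ = 1`.
  have hexp : ∏ i, Real.exp (μ i - 1) = 1 := by rw [← Real.exp_sum, hsum, Real.exp_zero]
  have hle : ∀ i, μ i ≤ Real.exp (μ i - 1) := fun i => by
    linarith [Real.add_one_le_exp (μ i - 1)]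
  rw [hdet]
  refine ⟨hexp ▸ Finset.prod_le_prod (fun i _ => (hμ0 i).le) fun i _ => hle i, fun heq => ?_⟩
  have hone : ∀ i, μ i = 1 := by
    by_contra! hne
    obtain ⟨i, hi⟩ := hne
    have h1 : μ i < Real.exp (μ i - 1) := by
      linarith [Real.add_one_lt_exp (sub_ne_zero.2 hi)]
    have h2 := Finset.prod_lt_prod (fun i _ => hμ0 i) (fun i _ => hle i)
      ⟨i, Finset.mem_univ i, h1⟩
    rw [heq, hexp] at h2
    exact h2.false
  have h3 := hA.isHermitian.spectral_theorem
  have h4 : (RCLike.ofReal ∘ hA.isHermitian.eigenvalues : n → ℂ) = fun _ => 1 := by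
    funext i
    simp [← hμ, hone i]
  rw [h4, diagonal_one, map_one] at h3
  exact h3

/-- **Hadamard's inequality**, with its case of equality. -/
theorem det_le_prod_diag (hA : A.PosDef) :
    A.det.re ≤ ∏ i, (A i i).re ∧ (A.det.re = ∏ i, (A i i).re → A.IsDiag) := by
  set s : n → ℝ := fun i => Real.sqrt (A i i).re with hs
  have hs0 : ∀ i, 0 < s i := fun i => Real.sqrt_pos.2 (hA.re_diag_pos i)
  have hs2 : ∀ i, s i ^ 2 = (A i i).re := fun i => Real.sq_sqrt (hA.re_diag_pos i).le
  -- Congruence by `S` normalizes the diagonal to one and preserves which entries vanish.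
  set S : Matrix n n ℂ := diagonal fun i => (((s i)⁻¹ : ℝ) : ℂ) with hS
  have hSH : Sᴴ = S := by
    rw [hS, diagonal_conjTranspose]
    congr 1
    funext i
    simp
  have hSu : IsUnit S := by
    rw [isUnit_iff_isUnit_det, hS, det_diagonal, isUnit_iff_ne_zero, Finset.prod_ne_zero_iff]
    intro i _
    exact Complex.ofReal_ne_zero.2 (inv_ne_zero (hs0 i).ne')
  have hB : (Sᴴ * A * S).PosDef :=
    hA.conjTranspose_mul_mul_same (mulVec_injective_iff_isUnit.2 hSu)
  rw [hSH] at hB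
  have hent : ∀ i j, (S * A * S) i j = (((s i)⁻¹ : ℝ) : ℂ) * A i j * (((s j)⁻¹ : ℝ) : ℂ) :=
    fun i j => by rw [hS, mul_diagonal, diagonal_mul]
  have hone : ∀ i, (S * A * S) i i = 1 := fun i => by
    rw [hent, ← hA.coe_re_diag i, ← hs2, ← Complex.ofReal_mul, ← Complex.ofReal_mul,
      Complex.ofReal_eq_one]
    have := (hs0 i).ne'
    field_simp
  have hprod : 0 < ∏ i, (A i i).re := Finset.prod_pos fun i _ => hA.re_diag_pos i
  have hdet : A.det.re = (∏ i, (A i i).re) * (S * A * S).det.re := by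
    have h1 : (S * A * S).det = (((∏ i, (A i i).re)⁻¹ : ℝ) : ℂ) * A.det := by
      rw [det_mul, det_mul, hS, det_diagonal, ← Complex.ofReal_prod, mul_right_comm,
        ← Complex.ofReal_mul, ← Finset.prod_mul_distrib, ← Finset.prod_inv_distrib]
      congr 3
      funext i
      rw [← hs2, sq, mul_inv]
    rw [h1, Complex.re_ofReal_mul, mul_inv_cancel_left₀ hprod.ne']
  obtain ⟨h1, h2⟩ := hB.det_le_one_of_diag_eq_one hone
  refine ⟨by rw [hdet]; nlinarith, fun heq i j hij => ?_⟩
  have h3 : (S * A * S).det.re = 1 := by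
    rw [hdet] at heq
    exact (mul_eq_left₀ hprod.ne').1 heq
  have h4 := hent i j
  rw [h2 h3, one_apply_ne hij, eq_comm, mul_eq_zero, mul_eq_zero] at h4
  rcases h4 with (h4 | h4) | h4
  · exact absurd h4 (Complex.ofReal_ne_zero.2 (inv_ne_zero (hs0 i).ne'))
  · exact h4
  · exact absurd h4 (Complex.ofReal_ne_zero.2 (inv_ne_zero (hs0 j).ne'))

end Matrix.PosDef

namespace ISACParams

variable {M : ℕ} {p : ISACParams M}

/-! ### The channel in the coordinates of its singular value decomposition -/

theorem singMat_mul_apply {Nc : ℕ} {n : Type*} (X : Matrix (Fin M) n ℂ) (i : Fin Nc) (j : n) :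
    (p.singMat Nc * X) i j =
      if h : (i : ℕ) < M then ((p.lam ⟨i, h⟩ : ℝ) : ℂ) * X ⟨i, h⟩ j else 0 := by
  rw [mul_apply]
  by_cases h : (i : ℕ) < M
  · rw [dif_pos h, Finset.sum_eq_single ⟨i, h⟩]
    · simp [singMat]
    · intro k _ hk
      have : ¬ (i : ℕ) = (k : ℕ) := fun h' => hk (Fin.ext h'.symm)
      simp [singMat, this]
    · simp
  · rw [dif_neg h]
    refine Finset.sum_eq_zero fun k _ => ?_
    have : ¬ (i : ℕ) = (k : ℕ) := fun h' => h (h' ▸ k.2)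
    simp [singMat, this]

theorem singMat_conj_apply {Nc : ℕ} (X : Matrix (Fin M) (Fin M) ℂ) (i j : Fin Nc) :
    (p.singMat Nc * X * (p.singMat Nc)ᴴ) i j =
      if h : (i : ℕ) < M ∧ (j : ℕ) < M then
        ((p.lam ⟨i, h.1⟩ : ℝ) : ℂ) * X ⟨i, h.1⟩ ⟨j, h.2⟩ * ((p.lam ⟨j, h.2⟩ : ℝ) : ℂ) else 0 := by
  have h1 : p.singMat Nc * X * (p.singMat Nc)ᴴ =
      p.singMat Nc * (p.singMat Nc * Xᴴ)ᴴ := by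
    rw [conjTranspose_mul, conjTranspose_conjTranspose, Matrix.mul_assoc]
  rw [h1, singMat_mul_apply]
  simp only [conjTranspose_apply, singMat_mul_apply]
  by_cases hi : (i : ℕ) < M <;> by_cases hj : (j : ℕ) < M <;> simp [hi, hj]
  ring

/-- The matrix whose determinant gives the rate, in the singular coordinates. -/
noncomputable def rateMat (p : ISACParams M) (Nc : ℕ) (X : Matrix (Fin M) (Fin M) ℂ) :
    Matrix (Fin Nc) (Fin Nc) ℂ :=
  1 + ((1 / p.sigC ^ 2 : ℝ) : ℂ) • (p.singMat Nc * X * (p.singMat Nc)ᴴ)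

theorem rateMat_posDef (Nc : ℕ) {X : Matrix (Fin M) (Fin M) ℂ} (hX : X.PosDef) :
    (p.rateMat Nc X).PosDef := by
  refine PosDef.one.add_posSemidef ?_
  refine (hX.posSemidef.mul_mul_conjTranspose_same _).smul ?_
  exact Complex.zero_le_real.2 (by positivity)

/-- Receive and transmit dimensions may differ, but every factor from index `r` on is one. -/
theorem Regular.prod_fin_eq (h : p.Regular) {Nc : ℕ} (hNc : p.r ≤ Nc) (q : Fin M → ℝ) :
    (∏ i : Fin Nc, if hi : (i : ℕ) < M then 1 + p.gain ⟨i, hi⟩ * q ⟨i, hi⟩ else 1) =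
      ∏ j, (1 + p.gain j * q j) := by
  set f : ℕ → ℝ := fun k => if hk : k < M then 1 + p.gain ⟨k, hk⟩ * q ⟨k, hk⟩ else 1 with hf
  have hone : ∀ k, p.r ≤ k → f k = 1 := by
    intro k hk
    by_cases hkM : k < M
    · simp [hf, hkM, h.gain_zero (i := ⟨k, hkM⟩) hk]
    · simp [hf, hkM]
  have hrange : ∀ m, p.r ≤ m → ∏ i : Fin m, f i = ∏ k ∈ Finset.range p.r, f k := by
    intro m hm
    rw [Fin.prod_univ_eq_prod_range]
    refine (Finset.prod_subset (Finset.range_mono hm) fun k _ hk => hone k ?_).symm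
    simpa using hk
  have h1 : ∏ j : Fin M, (1 + p.gain j * q j) = ∏ j : Fin M, f j :=
    Finset.prod_congr rfl fun j _ => by simp [hf]
  rw [h1, hrange M h.r_le, ← hrange Nc hNc]

theorem rateMat_diag (Nc : ℕ) {X : Matrix (Fin M) (Fin M) ℂ} (hX : X.PosDef) (i : Fin Nc) :
    (p.rateMat Nc X i i).re =
      if hi : (i : ℕ) < M then 1 + p.gain ⟨i, hi⟩ * (X ⟨i, hi⟩ ⟨i, hi⟩).re else 1 := by
  rw [rateMat, Matrix.add_apply, one_apply_eq, Matrix.smul_apply, singMat_conj_apply]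
  by_cases hi : (i : ℕ) < M
  · simp only [hi, and_self, dite_true]
    rw [← hX.coe_re_diag, smul_eq_mul, ← Complex.ofReal_mul, ← Complex.ofReal_mul,
      ← Complex.ofReal_mul, Complex.add_re, Complex.one_re, Complex.ofReal_re, Complex.ofReal_re,
      gain]
    ring
  · simp [hi]

/-- Hadamard's inequality for `rateMat`. Equality controls the entries of `X` only through `lam a *
X a b * lam b`, so recovering diagonality requires all singular values to be nonzero, i.e. `r = M`.
-/
theorem Regular.rateMat_det_le (h : p.Regular) {Nc : ℕ} (hNc : p.r ≤ Nc)
    {X : Matrix (Fin M) (Fin M) ℂ} (hX : X.PosDef) :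
    (p.rateMat Nc X).det.re ≤ ∏ j, (1 + p.gain j * (X j j).re) ∧
      (X.IsDiag → (p.rateMat Nc X).det.re = ∏ j, (1 + p.gain j * (X j j).re)) ∧
      (p.r = M → (p.rateMat Nc X).det.re = ∏ j, (1 + p.gain j * (X j j).re) → X.IsDiag) := by
  have hW := p.rateMat_posDef Nc hX
  have hprod : ∏ i, (p.rateMat Nc X i i).re = ∏ j, (1 + p.gain j * (X j j).re) := by
    rw [← h.prod_fin_eq hNc fun j => (X j j).re]
    exact Finset.prod_congr rfl fun i _ => rateMat_diag Nc hX i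
  rw [← hprod]
  obtain ⟨h1, h2⟩ := hW.det_le_prod_diag
  have hoff : ∀ i j : Fin Nc, i ≠ j → p.rateMat Nc X i j = ((1 / p.sigC ^ 2 : ℝ) : ℂ) *
      (p.singMat Nc * X * (p.singMat Nc)ᴴ) i j := fun i j hij => by
    rw [rateMat, Matrix.add_apply, one_apply_ne hij, Matrix.smul_apply, zero_add, smul_eq_mul]
  refine ⟨h1, fun hdiag => ?_, fun hr heq => ?_⟩
  · have hWd : (p.rateMat Nc X).IsDiag := by
      intro i j hij
      rw [hoff i j hij, singMat_conj_apply]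
      split_ifs with hlt
      · rw [hdiag (fun h' => hij (Fin.ext (Fin.mk.inj h')))]
        simp
      · simp
    have h3 : (p.rateMat Nc X).det = ((∏ i, (p.rateMat Nc X i i).re : ℝ) : ℂ) := by
      conv_lhs => rw [← hWd.diagonal_diag, det_diagonal]
      push_cast
      exact Finset.prod_congr rfl fun i _ => (hW.coe_re_diag i).symm
    rw [h3, Complex.ofReal_re]
  · intro a b hab
    have hMN : M ≤ Nc := hr ▸ hNc
    have h3 : p.rateMat Nc X _ _ = 0 := h2 heq (i := ⟨a, a.2.trans_le hMN⟩) (j := ⟨b, b.2.trans_le hMN⟩)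
      (fun h' => hab (Fin.ext (Fin.mk.inj h')))
    rw [hoff _ _ (fun h' => hab (Fin.ext (Fin.mk.inj h'))), singMat_conj_apply] at h3
    simp only [a.2, b.2, and_self, dite_true, Fin.eta] at h3
    have hsig := h.sigC_pos.ne'
    have hla : ((p.lam a : ℝ) : ℂ) ≠ 0 :=
      Complex.ofReal_ne_zero.2 (h.lam_pos a (a.2.trans_le hr.ge)).ne'
    have hlb : ((p.lam b : ℝ) : ℂ) ≠ 0 :=
      Complex.ofReal_ne_zero.2 (h.lam_pos b (b.2.trans_le hr.ge)).ne'
    simpa [hsig, hla, hlb] using h3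

/-- The singular value decomposition of the channel. -/
structure IsSVD (p : ISACParams M) {Nc : ℕ} (H : Matrix (Fin Nc) (Fin M) ℂ)
    (U : Matrix (Fin Nc) (Fin Nc) ℂ) (V : Matrix (Fin M) (Fin M) ℂ) : Prop where
  r_le : p.r ≤ Nc
  left_unitary : U ∈ Matrix.unitaryGroup (Fin Nc) ℂ
  right_unitary : V ∈ Matrix.unitaryGroup (Fin M) ℂ
  eq : H = U * p.singMat Nc * Vᴴ

/-! ### Passage between covariance matrices and power allocations -/

section SVD

variable {Nc : ℕ} {H : Matrix (Fin Nc) (Fin M) ℂ} {U : Matrix (Fin Nc) (Fin Nc) ℂ}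
  {V : Matrix (Fin M) (Fin M) ℂ}

theorem IsSVD.mul_star (hS : p.IsSVD H U V) : V * Vᴴ = 1 := mem_unitaryGroup_iff.1 hS.right_unitary

theorem IsSVD.star_mul (hS : p.IsSVD H U V) : Vᴴ * V = 1 := mem_unitaryGroup_iff'.1 hS.right_unitary

theorem IsSVD.left_mul_star (hS : p.IsSVD H U V) : U * Uᴴ = 1 :=
  mem_unitaryGroup_iff.1 hS.left_unitary

theorem IsSVD.det_rate (hS : p.IsSVD H U V) (Q : Matrix (Fin M) (Fin M) ℂ) :
    (1 + ((1 / p.sigC ^ 2 : ℝ) : ℂ) • (H * Q * Hᴴ)).det = (p.rateMat Nc (Vᴴ * Q * V)).det := by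
  have h1 : 1 + ((1 / p.sigC ^ 2 : ℝ) : ℂ) • (H * Q * Hᴴ) =
      U * p.rateMat Nc (Vᴴ * Q * V) * Uᴴ := by
    rw [rateMat, Matrix.mul_add, Matrix.add_mul, Matrix.mul_one, hS.left_mul_star,
      Matrix.mul_smul, Matrix.smul_mul, hS.eq]
    simp only [conjTranspose_mul, conjTranspose_conjTranspose, Matrix.mul_assoc]
  rw [h1, det_mul, det_mul, mul_right_comm, ← det_mul, hS.left_mul_star, det_one, one_mul]

theorem IsSVD.trace_conj (hS : p.IsSVD H U V) (Q : Matrix (Fin M) (Fin M) ℂ) :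
    (Vᴴ * Q * V).trace = Q.trace := by
  rw [trace_mul_comm, ← Matrix.mul_assoc, hS.mul_star, Matrix.one_mul]

theorem IsSVD.inv_conj (hS : p.IsSVD H U V) (Q : Matrix (Fin M) (Fin M) ℂ) :
    (Vᴴ * Q * V)⁻¹ = Vᴴ * Q⁻¹ * V := by
  have h1 : V⁻¹ = Vᴴ := inv_eq_left_inv hS.star_mul
  have h2 : (Vᴴ)⁻¹ = V := inv_eq_left_inv hS.mul_star
  rw [Matrix.mul_inv_rev, Matrix.mul_inv_rev, h1, h2, Matrix.mul_assoc]

theorem IsSVD.conj_posDef (hS : p.IsSVD H U V) {Q : Matrix (Fin M) (Fin M) ℂ} (hQ : Q.PosDef) :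
    (Vᴴ * Q * V).PosDef :=
  hQ.conjTranspose_mul_mul_same (mulVec_injective_iff_isUnit.2
    ((isUnit_iff_isUnit_det V).2 (isUnit_det_of_left_inverse hS.star_mul)))

/-- Energies of the eigenmodes under a covariance matrix. -/
noncomputable def alloc (V Q : Matrix (Fin M) (Fin M) ℂ) (τ : ℝ) (i : Fin M) : ℝ :=
  τ * ((Vᴴ * Q * V) i i).re

theorem IsSVD.energy_alloc (hS : p.IsSVD H U V) (Q : Matrix (Fin M) (Fin M) ℂ) (τ : ℝ) :
    p.energy (alloc V Q τ) τ = p.covEnergy Q τ := by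
  have h1 : Q.trace.re = ∑ i, ((Vᴴ * Q * V) i i).re := by
    rw [← hS.trace_conj, trace, Complex.re_sum]
    rfl
  unfold energy covEnergy alloc
  rw [h1, ← Finset.mul_sum]
  ring

theorem Regular.crb_alloc (h : p.Regular) (hS : p.IsSVD H U V) {Q : Matrix (Fin M) (Fin M) ℂ}
    (hQ : Q.PosDef) {τ : ℝ} (hτ : 0 < τ) :
    p.crb (alloc V Q τ) ≤ p.covCRB Q τ ∧
      (p.crb (alloc V Q τ) = p.covCRB Q τ ↔ (Vᴴ * Q * V).IsDiag) := by
  have hX := hS.conj_posDef hQ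
  obtain ⟨h1, h2⟩ := hX.sum_one_div_diag_le_trace_inv
  have h3 : (Vᴴ * Q * V).IsDiag →
      ∑ i, 1 / ((Vᴴ * Q * V) i i).re = ((Vᴴ * Q * V)⁻¹).trace.re := by
    intro hd
    have hinv : (Vᴴ * Q * V)⁻¹ = diagonal fun i => 1 / (Vᴴ * Q * V) i i := by
      refine inv_eq_right_inv ?_
      ext i j
      rw [mul_diagonal]
      rcases eq_or_ne i j with rfl | hij
      · rw [one_apply_eq, mul_one_div_cancel hX.diag_pos.ne']
      · rw [hd hij, zero_mul, one_apply_ne hij]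
    rw [hinv, trace_diagonal, Complex.re_sum]
    refine Finset.sum_congr rfl fun i _ => ?_
    rw [← hX.coe_re_diag i]
    norm_cast
  rw [hS.inv_conj, hS.trace_conj] at h1 h2 h3
  have hc : 0 < p.noise / τ := div_pos h.noise_pos hτ
  have h4 : p.crb (alloc V Q τ) = p.noise / τ * ∑ i, 1 / ((Vᴴ * Q * V) i i).re := by
    unfold crb alloc noise
    simp only [Finset.mul_sum]
    refine Finset.sum_congr rfl fun i _ => ?_
    field_simp
  have h5 : p.covCRB Q τ = p.noise / τ * (Q⁻¹).trace.re := by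
    unfold covCRB noise
    rw [div_div]
  rw [h4, h5]
  refine ⟨mul_le_mul_of_nonneg_left h1 hc.le, fun heq => h2 (mul_left_cancel₀ hc.ne' heq),
    fun hd => by rw [h3 hd]⟩

theorem Regular.rate_alloc (h : p.Regular) (hS : p.IsSVD H U V) {Q : Matrix (Fin M) (Fin M) ℂ}
    (hQ : Q.PosDef) {τ : ℝ} (hτ : 0 < τ) :
    p.covRate H Q τ ≤ p.rate (alloc V Q τ) τ ∧
      ((Vᴴ * Q * V).IsDiag → p.covRate H Q τ = p.rate (alloc V Q τ) τ) ∧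
      (p.r = M → p.covRate H Q τ = p.rate (alloc V Q τ) τ → (Vᴴ * Q * V).IsDiag) := by
  have hX := hS.conj_posDef hQ
  obtain ⟨h1, h2, h3⟩ := h.rateMat_det_le hS.r_le hX
  have hdet : 0 < (p.rateMat Nc (Vᴴ * Q * V)).det.re :=
    (Complex.pos_iff.1 (p.rateMat_posDef Nc hX).det_pos).1
  have hc : 0 < τ / p.Tmax := div_pos hτ h.Tmax_pos
  have hterm : ∀ i, 0 < 1 + p.gain i * ((Vᴴ * Q * V) i i).re := fun i => by
    have := p.gain_nonneg i
    have := hX.re_diag_pos i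
    positivity
  have h4 : p.rate (alloc V Q τ) τ = τ / p.Tmax *
      Real.logb 2 (∏ i, (1 + p.gain i * ((Vᴴ * Q * V) i i).re)) := by
    rw [h.rate_eq, Real.logb_prod _ _ fun i _ => (hterm i).ne']
    congr 1
    refine Finset.sum_congr rfl fun i _ => ?_
    rw [alloc, mul_left_comm, mul_div_cancel_left₀ _ hτ.ne']
  rw [h4, covRate, hS.det_rate]
  refine ⟨?_, fun hd => by rw [h2 hd], fun hr heq => h3 hr ?_⟩
  · gcongr
    exact one_lt_two
  · exact Real.logb_injOn_pos one_lt_two hdet (Finset.prod_pos fun i _ => hterm i)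
      (mul_left_cancel₀ hc.ne' heq)

theorem Regular.feasible_alloc (h : p.Regular) (hS : p.IsSVD H U V)
    {Q : Matrix (Fin M) (Fin M) ℂ} {τ : ℝ} (hf : p.CovFeasible H Q τ) :
    p.Feasible (alloc V Q τ) τ := by
  obtain ⟨hQ, hc, hr, hτ⟩ := hf
  have hτ0 := h.Tmin_pos.trans_le hτ.1
  exact ⟨⟨fun i => mul_pos hτ0 ((hS.conj_posDef hQ).re_diag_pos i), hτ⟩,
    (h.crb_alloc hS hQ hτ0).1.trans hc, hr.trans (h.rate_alloc hS hQ hτ0).1⟩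

/-- The covariance matrix with given energies of the eigenmodes. -/
noncomputable def covOf (V : Matrix (Fin M) (Fin M) ℂ) (e : Fin M → ℝ) (τ : ℝ) :
    Matrix (Fin M) (Fin M) ℂ :=
  ((1 / τ : ℝ) : ℂ) • (V * diagonal (fun i => ((e i : ℝ) : ℂ)) * Vᴴ)

theorem IsSVD.conj_covOf (hS : p.IsSVD H U V) (e : Fin M → ℝ) (τ : ℝ) :
    Vᴴ * covOf V e τ * V = diagonal fun i => ((1 / τ * e i : ℝ) : ℂ) := by
  have h1 : Vᴴ * (V * diagonal (fun i => ((e i : ℝ) : ℂ)) * Vᴴ) * V =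
      diagonal fun i => ((e i : ℝ) : ℂ) := by
    rw [Matrix.mul_assoc, Matrix.mul_assoc, Matrix.mul_assoc, hS.star_mul, Matrix.mul_one,
      ← Matrix.mul_assoc, hS.star_mul, Matrix.one_mul]
  rw [covOf, Matrix.mul_smul, Matrix.smul_mul, h1, ← diagonal_smul]
  congr 1
  funext i
  simp

theorem IsSVD.alloc_covOf (hS : p.IsSVD H U V) (e : Fin M → ℝ) {τ : ℝ} (hτ : 0 < τ) :
    alloc V (covOf V e τ) τ = e := by
  funext i
  rw [alloc, hS.conj_covOf, diagonal_apply_eq, Complex.ofReal_re]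
  field_simp

theorem IsSVD.covOf_alloc (hS : p.IsSVD H U V) {Q : Matrix (Fin M) (Fin M) ℂ} (hQ : Q.PosDef)
    {τ : ℝ} (hτ : 0 < τ) (hd : (Vᴴ * Q * V).IsDiag) : covOf V (alloc V Q τ) τ = Q := by
  have h1 : Vᴴ * covOf V (alloc V Q τ) τ * V = Vᴴ * Q * V := by
    rw [hS.conj_covOf, ← hd.diagonal_diag]
    congr 1
    funext i
    rw [diag_apply, alloc, ← mul_assoc, one_div_mul_cancel hτ.ne', one_mul,
      (hS.conj_posDef hQ).coe_re_diag]
  have h2 : ∀ X, V * (Vᴴ * X * V) * Vᴴ = X := fun X => by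
    rw [← Matrix.mul_assoc, ← Matrix.mul_assoc, hS.mul_star, Matrix.one_mul, Matrix.mul_assoc,
      hS.mul_star, Matrix.mul_one]
  rw [← h2 (covOf V _ τ), h1, h2]

theorem IsSVD.covOf_posDef (hS : p.IsSVD H U V) {e : Fin M → ℝ} (he : ∀ i, 0 < e i) {τ : ℝ}
    (hτ : 0 < τ) : (covOf V e τ).PosDef := by
  have h1 : (diagonal fun i => ((e i : ℝ) : ℂ)).PosDef :=
    PosDef.diagonal fun i => Complex.zero_lt_real.2 (he i)
  have h2 : IsUnit Vᴴ := (isUnit_iff_isUnit_det _).2 (isUnit_det_of_left_inverse hS.mul_star)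
  have h3 := h1.conjTranspose_mul_mul_same (mulVec_injective_iff_isUnit.2 h2)
  rw [conjTranspose_conjTranspose] at h3
  exact h3.smul (Complex.zero_lt_real.2 (by positivity))

theorem Regular.covFeasible_covOf (h : p.Regular) (hS : p.IsSVD H U V) {e : Fin M → ℝ} {τ : ℝ}
    (hf : p.Feasible e τ) : p.CovFeasible H (covOf V e τ) τ := by
  have hτ := h.Tmin_pos.trans_le hf.1.2.1
  have hQ := hS.covOf_posDef hf.1.1 hτ
  have hd : (Vᴴ * covOf V e τ * V).IsDiag := by
    rw [hS.conj_covOf]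
    exact isDiag_diagonal _
  have h1 := (h.crb_alloc hS hQ hτ).2.2 hd
  have h2 := (h.rate_alloc hS hQ hτ).2.1 hd
  rw [hS.alloc_covOf e hτ] at h1 h2
  exact ⟨hQ, h1 ▸ hf.2.1, h2 ▸ hf.2.2, hf.1.2⟩

theorem IsSVD.covEnergy_covOf (hS : p.IsSVD H U V) (e : Fin M → ℝ) {τ : ℝ} (hτ : 0 < τ) :
    p.covEnergy (covOf V e τ) τ = p.energy e τ := by
  rw [← hS.energy_alloc, hS.alloc_covOf e hτ]

/-- Optimal covariance matrices are those built from optimal power allocations. -/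
theorem Regular.covOptimal_iff (h : p.Regular) (hS : p.IsSVD H U V)
    (Q : Matrix (Fin M) (Fin M) ℂ) (τ : ℝ) :
    p.CovOptimal H Q τ ↔ ∃ e, p.Optimal e τ ∧ Q = covOf V e τ := by
  constructor
  · rintro ⟨hf, hmin⟩
    have hτ := h.Tmin_pos.trans_le hf.2.2.2.1
    -- Keeping the diagonal preserves feasibility and energy, and `covOf` turns every competitor
    -- into a covariance of equal energy.
    have ho : p.Optimal (alloc V Q τ) τ := by
      refine ⟨h.feasible_alloc hS hf, fun e' τ' hf' => ?_⟩
      rw [hS.energy_alloc, ← hS.covEnergy_covOf e' (h.Tmin_pos.trans_le hf'.1.2.1)]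
      exact hmin _ _ (h.covFeasible_covOf hS hf')
    refine ⟨_, ho, (hS.covOf_alloc hf.1 hτ ?_).symm⟩
    obtain ⟨hc1, hc2⟩ := h.crb_alloc hS hf.1 hτ
    obtain ⟨hr1, -, hr2⟩ := h.rate_alloc hS hf.1 hτ
    -- If the CRB constraint is tight for the diagonal, the CRB of `Q` is squeezed to equality.
    -- Otherwise every mode is active and the rate is tight, so equality holds in Hadamard's
    -- inequality.
    by_cases hcrb : p.crb (alloc V Q τ) = p.Gam
    · exact hc2.1 (le_antisymm hc1 (hcrb ▸ hf.2.1))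
    · have hr : p.r = M := by
        by_contra hne
        exact hcrb (h.crb_eq_of_lt ho (lt_of_le_of_ne h.r_le hne))
      have hrate := (h.crb_eq_or_rate_eq ho).resolve_left hcrb
      exact hr2 hr (le_antisymm hr1 (hrate ▸ hf.2.2.1))
  · rintro ⟨e, ho, rfl⟩
    have hτ := h.Tmin_pos.trans_le ho.1.1.2.1
    refine ⟨h.covFeasible_covOf hS ho.1, fun Q' τ' hf' => ?_⟩
    rw [hS.covEnergy_covOf e hτ, ← hS.energy_alloc]
    exact ho.2 _ _ (h.feasible_alloc hS hf')

end SVD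

end ISACParams

/-! ### Assembly of the theorem -/

theorem mainTheorem1 {M Nc : ℕ} (p : ISACParams M)
    (hNs : M ≤ p.Ns) (heta0 : 0 < p.eta) (heta1 : p.eta < 1) (hPc : 0 ≤ p.Pc)
    (hsigS : 0 < p.sigS) (hsigC : 0 < p.sigC) (hB : 0 < p.B) (hGam : 0 < p.Gam)
    (hR : 0 ≤ p.R) (hTmin : 0 < p.Tmin) (hT : p.Tmin ≤ p.Tmax)
    (H : Matrix (Fin Nc) (Fin M) ℂ) (hrank : H.rank = p.r) (hr : 1 ≤ p.r)
    (hanti : Antitone p.lam) (hpos : ∀ i : Fin M, (i : ℕ) < p.r → 0 < p.lam i)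
    (hzero : ∀ i : Fin M, p.r ≤ (i : ℕ) → p.lam i = 0)
    (U : Matrix (Fin Nc) (Fin Nc) ℂ) (hU : U ∈ Matrix.unitaryGroup (Fin Nc) ℂ)
    (V : Matrix (Fin M) (Fin M) ℂ) (hV : V ∈ Matrix.unitaryGroup (Fin M) ℂ)
    (hSVD : H = U * p.singMat Nc * Vᴴ) :
    -- primal and dual optimal solutions exist
    (∃ e τ, p.Optimal e τ) ∧ (∃ γ ν, p.DualOptimal γ ν) ∧
    (∀ γ ν, p.DualOptimal γ ν →
      -- the Cardano expression is a positive real number for every duration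
      (∀ i : Fin M, (i : ℕ) < p.r → ∀ t, 0 < t →
        (p.cardano γ ν i t).im = 0 ∧ 0 < p.ehat γ ν i t) ∧
      -- every optimal solution satisfies the stationarity equation and has the closed form
      (∀ e τ, p.Optimal e τ → p.Stationary γ ν e τ ∧ p.ClosedForm γ ν e τ) ∧
      -- if the equation for the duration does not have several solutions, then the closed form
      -- is optimal
      ((p.TauSol γ ν).Subsingleton → ∀ e τ, p.ClosedForm γ ν e τ → p.Optimal e τ) ∧
      -- it does not have several solutions when both multipliers are positive
      (0 < γ → 0 < ν → (p.TauSol γ ν).Subsingleton)) ∧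
    -- the optimal solutions of the covariance problem are obtained from those of power allocation
    (∀ Q τ, p.CovOptimal H Q τ ↔
      ∃ e, p.Optimal e τ ∧
        Q = ((1 / τ : ℝ) : ℂ) • (V * Matrix.diagonal (fun i => ((e i : ℝ) : ℂ)) * Vᴴ)) := by
  have hrM : p.r ≤ M := by
    have := H.rank_le_card_width
    rwa [hrank, Fintype.card_fin] at this
  have hrN : p.r ≤ Nc := by
    have := H.rank_le_card_height
    rwa [hrank, Fintype.card_fin] at this
  have h : p.Regular :=
    { eta_pos := heta0
      Pc_nonneg := hPc
      sigS_pos := hsigS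
      sigC_pos := hsigC
      B_pos := hB
      Ns_pos := Nat.cast_pos.2 (hr.trans (hrM.trans hNs))
      Gam_pos := hGam
      Tmin_pos := hTmin
      Tmin_le := hT
      r_pos := hr
      r_le := hrM
      lam_pos := hpos
      lam_zero := hzero }
  refine ⟨h.exists_optimal, h.exists_dualOptimal, fun γ ν hdual => ?_,
    h.covOptimal_iff ⟨hrN, hU, hV, hSVD⟩⟩
  have hp := h.proper hdual
  exact ⟨fun i hi t ht => ⟨h.cardano_im hp hi ht, h.ehat_pos hp hi ht⟩,
    fun e τ ho => ⟨h.stationary hdual ho, h.closedForm hdual ho⟩,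
    fun hsub e τ hcf => h.optimal_of_closedForm hdual hsub hcf,
    fun hγ hν => h.tauSol_subsingleton hp hγ hν⟩
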